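/- Let $(W,S)$ be a Coxeter system with $W$ finite, let $Q=(q_1,\dots,q_r)$ be a word in $S$ and let $\pi\in W$. The subword complex $\Delta(Q,\pi)$ is the simplicial complex on $[r]=\{1,\dots,r\}$ whose facets are the sets $I\subseteq[r]$ such that the subword of $Q$ formed by the letters at the positions in $[r]\setminus I$ is a reduced expression of $\pi$. Suppose that $\Delta(Q,\pi)$ is spherical, that is, its geometric realization is homeomorphic to a sphere. Then for every vertex $\{i\}\in\Delta(Q,\pi)$ the deletion $$\operatorname{del}(\Delta(Q,\pi),i)=\{J\in\Delta(Q,\pi) : i\notin J\}$$ is vertex decomposable. Here a finite simplicial complex $\Delta$ is (recursively) vertex decomposable if either it is a simplex (the set of all subsets of some finite set), or it is pure (all its facets have the same cardinality) and has a vertex $v$ such that both the deletion $\{J\in\Delta : v\notin J\}$ and the link $\{J\in\Delta : v\notin J,\ J\cup\{v\}\in\Delta\}$ are vertex decomposable. -/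

import Mathlib

namespace SimpComplex

/-- The facets of a simplicial complex, i.e. its maximal faces.  A simplicial complex on the vertex
set `V` is a family of finite subsets of `V` closed under passing to subsets, that is, a term of
`LowerSet (Finset V)`. -/
def IsFacet {V : Type*} (Δ : LowerSet (Finset V)) (F : Finset V) : Prop :=
  F ∈ Δ ∧ ∀ G ∈ Δ, F ⊆ G → G = F

/-- A complex is pure if all its facets have the same dimension. -/
def IsPure {V : Type*} (Δ : LowerSet (Finset V)) : Prop :=
  ∀ F G : Finset V, IsFacet Δ F → IsFacet Δ G → F.card = G.card

/-- The full simplex on the vertex set `F`: its faces are all subsets of `F`. -/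
def simplex {V : Type*} (F : Finset V) : LowerSet (Finset V) where
  carrier := {J | J ⊆ F}
  lower' _ _ hba ha := Finset.Subset.trans hba ha

/-- The deletion of `I`: the faces that do not contain `I`. -/
def deletion {V : Type*} (Δ : LowerSet (Finset V)) (I : Finset V) : LowerSet (Finset V) where
  carrier := {J | J ∈ Δ ∧ ¬ I ⊆ J}
  lower' _ _ hba ha := ⟨Δ.lower hba ha.1, fun h => ha.2 (Finset.Subset.trans h hba)⟩

/-- The link of `I`: the faces `J` disjoint from `I` such that `I ∪ J` is a face. -/
def link {V : Type*} [DecidableEq V] (Δ : LowerSet (Finset V)) (I : Finset V) :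
    LowerSet (Finset V) where
  carrier := {J | J ∈ Δ ∧ I ∪ J ∈ Δ ∧ Disjoint I J}
  lower' _ _ hba ha := ⟨Δ.lower hba ha.1,
    Δ.lower (Finset.union_subset_union_right hba) ha.2.1, ha.2.2.mono_right hba⟩

/-- A complex is vertex decomposable if it is a simplex, or it is pure and has a vertex whose
deletion and link are both vertex decomposable. -/
inductive VertexDecomposable {V : Type*} [DecidableEq V] : LowerSet (Finset V) → Prop
  | of_simplex (F : Finset V) : VertexDecomposable (simplex F)
  | of_vertex (Δ : LowerSet (Finset V)) (v : V) (hpure : IsPure Δ) (hv : {v} ∈ Δ)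
      (hdel : VertexDecomposable (deletion Δ {v})) (hlink : VertexDecomposable (link Δ {v})) :
      VertexDecomposable Δ

/-- The standard geometric realization: the union over the faces `I` of the convex hulls of the
standard basis vectors `e_i`, `i ∈ I`.  It carries the subspace topology. -/
def realization {V : Type*} [DecidableEq V] (Δ : LowerSet (Finset V)) : Set (V → ℝ) :=
  ⋃ I ∈ Δ, convexHull ℝ ((fun i : V => (Pi.single i 1 : V → ℝ)) '' (I : Set V))

/-- A complex on a finite vertex set is spherical if its geometric realization is homeomorphic to
the unit sphere of some `ℝⁿ` (for `n = 0` this is the empty sphere of dimension `-1`). -/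
def IsSpherical {V : Type*} [Fintype V] [DecidableEq V] (Δ : LowerSet (Finset V)) : Prop :=
  ∃ n : ℕ, Nonempty (realization Δ ≃ₜ Metric.sphere (0 : EuclideanSpace ℝ (Fin n)) 1)

end SimpComplex

/-- The subword of `Q` formed by the letters at the positions in `J`, in their order in `Q`. -/
def subwordAt {B : Type*} {r : ℕ} (Q : Fin r → B) (J : Finset (Fin r)) : List B :=
  ((List.finRange r).filter (fun k => k ∈ J)).map Q

/-- `ω` is a reduced expression of `w`. -/
def IsReducedExpression {B W : Type*} [Group W] {M : CoxeterMatrix B} (cs : CoxeterSystem M W)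
    (ω : List B) (w : W) : Prop :=
  cs.wordProd ω = w ∧ cs.IsReduced ω

/-- The subword complex of a word `Q` in the simple generators and a group element `w`: the complex
on the positions of `Q` generated by the sets `I` of positions such that the letters of `Q` outside
`I` form a reduced expression of `w`. -/
def subwordComplex {B W : Type*} [Group W] {M : CoxeterMatrix B} (cs : CoxeterSystem M W)
    {r : ℕ} (Q : Fin r → B) (w : W) : LowerSet (Finset (Fin r)) where
  carrier := {J | ∃ I : Finset (Fin r), J ⊆ I ∧ IsReducedExpression cs (subwordAt Q Iᶜ) w}
  lower' _ _ hba := fun ⟨I, hI, hred⟩ => ⟨I, Finset.Subset.trans hba hI, hred⟩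

/-!
Write `δ` for the Demazure product of `Q`, the Bruhat-largest element having a reduced expression
that is a subword of `Q`.

If `w ≠ δ`, removing the first letter exhibits `Δ(Q, w)` either as a cone, or as a union of a
complex of the same kind and a cone, meeting in a complex of the same kind; so by induction its
realization is an absolute extensor. A sphere is not, for otherwise the ball would retract onto its
boundary. Hence a spherical `Δ(Q, w)` has `w = δ`. The no-retraction theorem is proved with the
argument of Milnor and Rogers: for a `C¹` retraction `g` the volume of the image of the ball under
`x + t (g x - x)` is a polynomial in `t`, constant for small `t`, yet zero at `t = 1`.

If `w = δ`, then deleting the vertex `i` amounts to forcing the letter `i` to be used. This leads to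
the complexes of factorizations `w = a m c` with additive lengths, `a` and `c` being given by
subwords of `A` and `C`: the deletion of `i` is the case `m = sᵢ`, where `A` and `C` are the parts
of `Q` before and after `i`. When `w` is longest among the elements so obtained, the link of the
first letter of `C` is the complex with that letter removed, and its deletion is the complex with
that letter absorbed into `m` if this lengthens `m`; if it does not, no factorization uses the
letter and the complex is a cone. Consuming `C`, and then `A` by inversion, proves vertex
decomposability by induction.
-/

section Tietze

universe u v

variable {Y : Type u} {Z : Type v} [TopologicalSpace Y]

lemma exists_continuous_eqOn_of_tietzeExtension [NormalSpace Y] [TopologicalSpace Z] {s : Set Y}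
    {t : Set Z} [TietzeExtension.{u, v} t] (hs : IsClosed s) {f : Y → Z} (hf : ContinuousOn f s)
    (hft : Set.MapsTo f s t) : ∃ g : Y → Z, Continuous g ∧ (∀ y, g y ∈ t) ∧ Set.EqOn g f s := by
  obtain ⟨g, hgt, hgf⟩ := ContinuousMap.exists_forall_mem_restrict_eq hs
    ⟨s.domRestrict f, hf.domRestrict⟩ (t := t) fun x => hft x.2
  exact ⟨g, g.continuous, hgt, fun y hy => DFunLike.congr_fun hgf ⟨y, hy⟩⟩

lemma tietzeExtension_of_retraction [TopologicalSpace Z] [TietzeExtension.{u, v} Z] {t : Set Z}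
    {ρ : Z → Z} (hρ : Continuous ρ) (hρt : ∀ z, ρ z ∈ t) (hid : ∀ z ∈ t, ρ z = z) :
    TietzeExtension.{u, v} t :=
  .of_retract ⟨Subtype.val, continuous_subtype_val⟩ ⟨fun z => ⟨ρ z, hρt z⟩, hρ.subtype_mk hρt⟩
    (ContinuousMap.ext fun z => Subtype.ext (hid z z.2))

lemma exists_continuousOn_union_of_isClosed [TopologicalSpace Z] {s t : Set Y} (hs : IsClosed s)
    (ht : IsClosed t) {f g : Y → Z} (hf : ContinuousOn f s) (hg : ContinuousOn g t)
    (hfg : Set.EqOn f g (s ∩ t)) :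
    ∃ h : Y → Z, ContinuousOn h (s ∪ t) ∧ Set.EqOn h f s ∧ Set.EqOn h g t := by
  classical
  have hhf : Set.EqOn (s.piecewise f g) f s := s.piecewise_eqOn f g
  have hhg : Set.EqOn (s.piecewise f g) g t := fun y hy => by
    by_cases hys : y ∈ s
    · rw [hhf hys, hfg ⟨hys, hy⟩]
    · exact s.piecewise_eq_of_notMem f g hys
  exact ⟨_, (hf.congr hhf).union_of_isClosed (hg.congr hhg) hs ht, hhf, hhg⟩

lemma exists_isClosed_cover_mapsTo [NormalSpace Y] [PseudoMetricSpace Z] {t₁ t₂ : Set Z}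
    (ht₁ : IsClosed t₁) (ht₂ : IsClosed t₂) (hne₁ : t₁.Nonempty) (hne₂ : t₂.Nonempty) {A : Set Y}
    (hA : IsClosed A) {f : Y → Z} (hf : ContinuousOn f A) (hft : Set.MapsTo f A (t₁ ∪ t₂)) :
    ∃ s₁ s₂ : Set Y, IsClosed s₁ ∧ IsClosed s₂ ∧ s₁ ∪ s₂ = Set.univ ∧
      Set.MapsTo f (A ∩ s₁) t₁ ∧ Set.MapsTo f (A ∩ s₂) t₂ := by
  set d : Y → ℝ := fun y => Metric.infDist (f y) t₁ - Metric.infDist (f y) t₂ with hd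
  have hdA : ContinuousOn d A := by fun_prop
  obtain ⟨u, hu⟩ := ContinuousMap.exists_restrict_eq hA ⟨A.domRestrict d, hdA.domRestrict⟩
  have huA : Set.EqOn u d A := fun y hy => DFunLike.congr_fun hu ⟨y, hy⟩
  refine ⟨{y | u y ≤ 0}, {y | 0 ≤ u y}, isClosed_le u.continuous continuous_const,
    isClosed_le continuous_const u.continuous, Set.eq_univ_of_forall fun y => le_total (u y) 0,
    ?_, ?_⟩
  · rintro y ⟨hy, hu₀ : u y ≤ 0⟩
    refine (hft hy).elim id fun h₂ => (ht₁.mem_iff_infDist_zero hne₁).2 ?_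
    rw [huA hy, hd] at hu₀
    linarith [Metric.infDist_zero_of_mem h₂, Metric.infDist_nonneg (x := f y) (s := t₁)]
  · rintro y ⟨hy, hu₀ : 0 ≤ u y⟩
    refine (hft hy).elim (fun h₁ => (ht₂.mem_iff_infDist_zero hne₂).2 ?_) id
    rw [huA hy, hd] at hu₀
    linarith [Metric.infDist_zero_of_mem h₁, Metric.infDist_nonneg (x := f y) (s := t₂)]

lemma exists_continuous_eqOn_of_isClosed_cover [NormalSpace Y] [TopologicalSpace Z] {t₁ t₂ : Set Z}
    [TietzeExtension.{u, v} t₁] [TietzeExtension.{u, v} t₂] [TietzeExtension.{u, v} ↥(t₁ ∩ t₂)]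
    {A s₁ s₂ : Set Y} (hA : IsClosed A) (hs₁ : IsClosed s₁) (hs₂ : IsClosed s₂)
    (hcover : s₁ ∪ s₂ = Set.univ) {f : Y → Z} (hf : ContinuousOn f A)
    (hf₁ : Set.MapsTo f (A ∩ s₁) t₁) (hf₂ : Set.MapsTo f (A ∩ s₂) t₂) :
    ∃ g : Y → Z, Continuous g ∧ (∀ y, g y ∈ t₁ ∪ t₂) ∧ Set.EqOn g f A := by
  obtain ⟨k, hk, hkt, hkf⟩ := exists_continuous_eqOn_of_tietzeExtension (t := t₁ ∩ t₂)
    (hA.inter (hs₁.inter hs₂)) (hf.mono Set.inter_subset_left)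
    fun y hy => ⟨hf₁ ⟨hy.1, hy.2.1⟩, hf₂ ⟨hy.1, hy.2.2⟩⟩
  obtain ⟨h, hh, hhf, hhk⟩ := exists_continuousOn_union_of_isClosed hA (hs₁.inter hs₂) hf
    hk.continuousOn hkf.symm
  have hext : ∀ s t : Set _, [TietzeExtension.{u, v} t] → IsClosed s → Set.MapsTo f (A ∩ s) t →
      (∀ y, k y ∈ t) → ∃ g : Y → Z, Continuous g ∧ (∀ y, g y ∈ t) ∧
        Set.EqOn g h (A ∩ s ∪ s₁ ∩ s₂) := fun s t _ hs hft hkt => by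
    refine exists_continuous_eqOn_of_tietzeExtension ((hA.inter hs).union (hs₁.inter hs₂))
      (hh.mono (Set.union_subset_union_left _ Set.inter_subset_left)) ?_
    rintro y (hy | hy)
    · exact hhf hy.1 ▸ hft hy
    · exact hhk hy ▸ hkt y
  obtain ⟨g₁, hg₁, hg₁t, hg₁h⟩ := hext s₁ t₁ hs₁ hf₁ fun y => (hkt y).1
  obtain ⟨g₂, hg₂, hg₂t, hg₂h⟩ := hext s₂ t₂ hs₂ hf₂ fun y => (hkt y).2
  obtain ⟨g, hg, hgg₁, hgg₂⟩ := exists_continuousOn_union_of_isClosed hs₁ hs₂ hg₁.continuousOn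
    hg₂.continuousOn fun y hy => by rw [hg₁h (.inr hy), hg₂h (.inr hy)]
  have hs : ∀ y, y ∈ s₁ ∨ y ∈ s₂ := fun y => by simp [← Set.mem_union, hcover]
  refine ⟨g, continuousOn_univ.1 (hcover ▸ hg), fun y => ?_, fun y hy => ?_⟩
  · exact (hs y).imp (fun h₁ => hgg₁ h₁ ▸ hg₁t y) fun h₂ => hgg₂ h₂ ▸ hg₂t y
  · rcases hs y with hy₁ | hy₂
    · rw [hgg₁ hy₁, hg₁h (.inl ⟨hy, hy₁⟩), hhf hy]
    · rw [hgg₂ hy₂, hg₂h (.inl ⟨hy, hy₂⟩), hhf hy]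

lemma nonempty_of_tietzeExtension (Z : Type v) [TopologicalSpace Z] [TietzeExtension.{u, v} Z] :
    Nonempty Z := by
  obtain ⟨g, -⟩ := ContinuousMap.exists_restrict_eq (X := PUnit.{u + 1}) (Y := Z) isClosed_empty
    ⟨isEmptyElim, continuous_of_const fun x => x.2.elim⟩
  exact ⟨g PUnit.unit⟩

theorem tietzeExtension_union [PseudoMetricSpace Z] {t₁ t₂ : Set Z} (ht₁ : IsClosed t₁)
    (ht₂ : IsClosed t₂) (h₁ : TietzeExtension.{u, v} t₁) (h₂ : TietzeExtension.{u, v} t₂)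
    (h : TietzeExtension.{u, v} ↥(t₁ ∩ t₂)) : TietzeExtension.{u, v} ↥(t₁ ∪ t₂) where
  exists_restrict_eq' {Y} _ _ A hA f := by
    obtain ⟨z, hz₁, hz₂⟩ := Set.nonempty_coe_sort.1 (nonempty_of_tietzeExtension.{u, v} ↥(t₁ ∩ t₂))
    set F : Y → Z := Function.extend Subtype.val (fun y => (f y : Z)) fun _ => z
    have hFf : ∀ y : A, F y = f y := Subtype.val_injective.extend_apply _ _
    have hF : ContinuousOn F A := continuousOn_iff_continuous_domRestrict.2 <|
      (continuous_subtype_val.comp f.continuous).congr fun y => (hFf y).symm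
    have hFt : Set.MapsTo F A (t₁ ∪ t₂) := fun y hy => by simp [hFf ⟨y, hy⟩, -Set.mem_union]
    obtain ⟨s₁, s₂, hs₁, hs₂, hcover, hF₁, hF₂⟩ :=
      exists_isClosed_cover_mapsTo ht₁ ht₂ ⟨z, hz₁⟩ ⟨z, hz₂⟩ hA hF hFt
    obtain ⟨g, hg, hgt, hgF⟩ :=
      exists_continuous_eqOn_of_isClosed_cover hA hs₁ hs₂ hcover hF hF₁ hF₂
    exact ⟨⟨fun y => ⟨g y, hgt y⟩, hg.subtype_mk hgt⟩,
      ContinuousMap.ext fun y => Subtype.ext ((hgF y.2).trans (hFf y))⟩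

end Tietze

namespace SimpComplex

section Simplex

variable {V : Type*}

lemma simplex_inf_simplex [DecidableEq V] {F G : Finset V} :
    simplex F ⊓ simplex G = simplex (F ∩ G) := by
  ext J
  exact Finset.subset_inter_iff.symm

/-- The complex of all sets that become faces of `Δ` on removing `v`; if `v` is not a vertex of `Δ`,
this is the cone over `Δ` with apex `v`. -/
def cone [DecidableEq V] (v : V) (Δ : LowerSet (Finset V)) : LowerSet (Finset V) where
  carrier := {J | J.erase v ∈ Δ}
  lower' _ _ hba := Δ.lower (Finset.erase_subset_erase v hba)

lemma mem_cone [DecidableEq V] {Δ : LowerSet (Finset V)} {v : V} {J : Finset V} :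
    J ∈ cone v Δ ↔ J.erase v ∈ Δ := Iff.rfl

/-- A retraction onto the simplex with vertex set `F ∋ v`: truncate the coordinates to nonnegative
values supported on `F`, then rescale if their sum `s` exceeds `1`, and add `1 - s` at `v`
otherwise. -/
noncomputable def simplexRetraction [DecidableEq V] (F : Finset V) (v : V) (x : V → ℝ) : V → ℝ :=
  (max 1 (∑ i ∈ F, max (x i) 0))⁻¹ • ((F : Set V).indicator (fun i => max (x i) 0) +
    max 0 (1 - ∑ i ∈ F, max (x i) 0) • Pi.single v 1)

lemma continuous_simplexRetraction [DecidableEq V] {F : Finset V} (v : V) :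
    Continuous (simplexRetraction F v) := by
  have hinv : Continuous fun x : V → ℝ => (max 1 (∑ i ∈ F, max (x i) 0))⁻¹ :=
    .inv₀ (by fun_prop) fun x => by positivity
  have hind : Continuous fun x : V → ℝ => (F : Set V).indicator fun i => max (x i) 0 := by
    refine continuous_pi fun i => ?_
    by_cases hi : i ∈ F
    · simp only [Finset.mem_coe, hi, Set.indicator_of_mem]
      fun_prop
    · simp only [Finset.mem_coe, hi, not_false_eq_true, Set.indicator_of_notMem]
      fun_prop
  unfold simplexRetraction
  fun_prop

variable [Fintype V]

/-- The points in barycentric coordinates whose support is a face of `Δ`; this is the geometric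
realization, described by equations and inequalities. -/
def barycentric (Δ : LowerSet (Finset V)) : Set (V → ℝ) :=
  {x | x ∈ stdSimplex ℝ V ∧ ({i | x i ≠ 0} : Finset V) ∈ Δ}

variable {Δ Γ : LowerSet (Finset V)} {F : Finset V}

lemma barycentric_sup : barycentric (Δ ⊔ Γ) = barycentric Δ ∪ barycentric Γ := by
  ext x
  exact and_or_left

lemma barycentric_inf : barycentric (Δ ⊓ Γ) = barycentric Δ ∩ barycentric Γ := by
  ext x
  exact and_and_left

lemma mem_barycentric_simplex {x : V → ℝ} :
    x ∈ barycentric (simplex F) ↔ x ∈ stdSimplex ℝ V ∧ ∀ i ∉ F, x i = 0 := by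
  refine and_congr_right fun _ => ?_
  simp only [simplex, LowerSet.mem_mk, Set.mem_ofPred_eq, Finset.subset_iff, Finset.mem_filter_univ]
  exact forall_congr' fun i => not_imp_comm

lemma sum_eq_one_of_mem_barycentric_simplex {x : V → ℝ} (hx : x ∈ barycentric (simplex F)) :
    ∑ i ∈ F, x i = 1 := by
  obtain ⟨⟨-, hsum⟩, hF⟩ := mem_barycentric_simplex.1 hx
  rw [← hsum]
  exact Finset.sum_subset F.subset_univ fun i _ => hF i

lemma convex_barycentric_simplex : Convex ℝ (barycentric (simplex F)) := by
  intro x hx y hy a b ha hb hab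
  rw [mem_barycentric_simplex] at *
  exact ⟨convex_stdSimplex ℝ V hx.1 hy.1 ha hb hab, fun i hi => by simp [hx.2 i hi, hy.2 i hi]⟩

variable [DecidableEq V]

lemma single_mem_barycentric_simplex {i : V} (hi : i ∈ F) :
    Pi.single i 1 ∈ barycentric (simplex F) :=
  mem_barycentric_simplex.2 ⟨single_mem_stdSimplex ℝ i, fun _ hj =>
    Pi.single_eq_of_ne (ne_of_mem_of_not_mem hi hj).symm 1⟩

lemma barycentric_simplex : barycentric (simplex F) =
    convexHull ℝ ((fun i : V => (Pi.single i 1 : V → ℝ)) '' (F : Set V)) := by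
  refine Set.Subset.antisymm (fun x hx => ?_) (convexHull_min ?_ convex_barycentric_simplex)
  · obtain ⟨⟨hnonneg, -⟩, hF⟩ := mem_barycentric_simplex.1 hx
    have hx_eq : ∑ i ∈ F, x i • (Pi.single i 1 : V → ℝ) = x := by
      ext j
      simpa [Finset.sum_apply, Pi.single_apply] using fun hj => (hF j hj).symm
    rw [← hx_eq]
    exact (convex_convexHull ℝ _).sum_mem (fun i _ => hnonneg i)
      (sum_eq_one_of_mem_barycentric_simplex hx) fun i hi => subset_convexHull ℝ _ ⟨i, hi, rfl⟩
  · rintro _ ⟨i, hi, rfl⟩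
    exact single_mem_barycentric_simplex hi

variable (Δ) in
lemma realization_eq_barycentric : realization Δ = barycentric Δ := by
  ext x
  simp only [realization, Set.mem_iUnion, ← barycentric_simplex, exists_prop]
  exact ⟨fun ⟨I, hI, hx, hxI⟩ => ⟨hx, Δ.lower hxI hI⟩, fun ⟨hx, hxΔ⟩ =>
    ⟨_, hxΔ, hx, Finset.Subset.refl _⟩⟩

lemma simplexRetraction_mem {v : V} (hv : v ∈ F) (x : V → ℝ) :
    simplexRetraction F v x ∈ barycentric (simplex F) := by
  set s := ∑ i ∈ F, max (x i) 0 with hs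
  have hpos : 0 < max 1 s := by positivity
  have hsum : s + max 0 (1 - s) = max 1 s := by
    rcases le_total s 1 with h | h <;> simp [h]
  refine mem_barycentric_simplex.2 ⟨⟨fun i => ?_, ?_⟩, fun i hi => ?_⟩
  · have h₁ : 0 ≤ (F : Set V).indicator (fun i => max (x i) 0) i :=
      Set.indicator_nonneg (fun _ _ => le_max_right _ _) i
    have h₂ : (0 : ℝ) ≤ Pi.single (M := fun _ => ℝ) v 1 i := (single_mem_stdSimplex ℝ v).1 i
    simp only [simplexRetraction, ← hs, Pi.smul_apply, Pi.add_apply, smul_eq_mul]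
    positivity
  · simp only [simplexRetraction, ← hs, Pi.smul_apply, Pi.add_apply, smul_eq_mul, ← Finset.mul_sum,
      Finset.sum_add_distrib, Finset.sum_indicator_subset _ F.subset_univ, Finset.sum_pi_single',
      Finset.mem_univ, if_true, mul_one, hsum, inv_mul_cancel₀ hpos.ne']
  · simp [simplexRetraction, hi, (ne_of_mem_of_not_mem hv hi).symm]

lemma simplexRetraction_of_mem {v : V} {x : V → ℝ} (hx : x ∈ barycentric (simplex F)) :
    simplexRetraction F v x = x := by
  obtain ⟨⟨hnonneg, -⟩, hF⟩ := mem_barycentric_simplex.1 hx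
  have hind : (F : Set V).indicator x = x :=
    Set.indicator_eq_self.2 fun i hi => by_contra fun h => hi (hF i h)
  simp [simplexRetraction, hnonneg, sum_eq_one_of_mem_barycentric_simplex hx, hind]

end Simplex

section Tietze

universe u v

variable {V : Type v} [Fintype V] {Δ : LowerSet (Finset V)} {v : V}

lemma isClosed_barycentric (Δ : LowerSet (Finset V)) : IsClosed (barycentric Δ) := by
  classical
  rw [← realization_eq_barycentric]
  refine (Set.toFinite (Δ : Set (Finset V))).isClosed_biUnion fun I _ => ?_
  exact ((Set.toFinite _).isCompact_convexHull (𝕜 := ℝ)).isClosed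

lemma tietzeExtension_barycentric_simplex {F : Finset V} (hv : v ∈ F) :
    TietzeExtension.{u, v} (barycentric (simplex F)) := by
  classical
  exact tietzeExtension_of_retraction (continuous_simplexRetraction v) (simplexRetraction_mem hv)
    fun _ => simplexRetraction_of_mem

lemma tietzeExtension_barycentric_sup {Γ : LowerSet (Finset V)}
    (hΔ : TietzeExtension.{u, v} (barycentric Δ)) (hΓ : TietzeExtension.{u, v} (barycentric Γ))
    (h : TietzeExtension.{u, v} (barycentric (Δ ⊓ Γ))) :
    TietzeExtension.{u, v} (barycentric (Δ ⊔ Γ)) := by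
  classical
  rw [barycentric_sup]
  rw [barycentric_inf] at h
  exact tietzeExtension_union (isClosed_barycentric Δ) (isClosed_barycentric Γ) hΔ hΓ h

lemma tietzeExtension_barycentric_sup_simplex {α : Type*} {s : Finset α} (hs : s.Nonempty)
    {F : α → Finset V} (hF : ∀ i ∈ s, v ∈ F i) :
    TietzeExtension.{u, v} (barycentric (s.sup fun i => simplex (F i))) := by
  classical
  induction hs using Finset.Nonempty.cons_induction generalizing F with
  | singleton i =>
    rw [Finset.sup_singleton]
    exact tietzeExtension_barycentric_simplex (hF i (Finset.mem_singleton_self i))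
  | cons i s hi _ ih =>
    have hFi := hF i (Finset.mem_cons_self i s)
    have hFs : ∀ j ∈ s, v ∈ F j := fun j hj => hF j (Finset.mem_cons_of_mem hj)
    rw [Finset.sup_cons]
    refine tietzeExtension_barycentric_sup (tietzeExtension_barycentric_simplex hFi) (ih hFs) ?_
    have hinf : simplex (F i) ⊓ (s.sup fun j => simplex (F j)) =
        s.sup fun j => simplex (F i ∩ F j) := by
      simp only [Finset.sup_inf_distrib_left, simplex_inf_simplex]
    rw [hinf]
    exact ih fun j hj => Finset.mem_inter.2 ⟨hFi, hFs j hj⟩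

theorem tietzeExtension_barycentric_cone [DecidableEq V] (hΔ : ∅ ∈ Δ) :
    TietzeExtension.{u, v} (barycentric (cone v Δ)) := by
  classical
  set 𝓕 : Finset (Finset V) := {F | F ∈ cone v Δ ∧ v ∈ F} with h𝓕
  have h_mem : ∀ {F}, F ∈ 𝓕 ↔ F ∈ cone v Δ ∧ v ∈ F := by simp [h𝓕]
  have hne : 𝓕.Nonempty := ⟨{v}, h_mem.2 ⟨by simpa [mem_cone], Finset.mem_singleton_self v⟩⟩
  have hcone : cone v Δ = 𝓕.sup simplex := by
    refine le_antisymm (fun J hJ => ?_) (Finset.sup_le fun F hF J hJ =>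
      (cone v Δ).lower hJ (h_mem.1 hF).1)
    have hinsert : insert v J ∈ 𝓕 :=
      h_mem.2 ⟨by simpa [mem_cone] using hJ, Finset.mem_insert_self v J⟩
    exact Finset.le_sup (f := simplex) hinsert (Finset.subset_insert v J)
  rw [hcone]
  exact tietzeExtension_barycentric_sup_simplex hne fun F hF => (h_mem.1 hF).2

end Tietze

end SimpComplex

section NoRetraction

open MeasureTheory Metric Polynomial
open scoped Topology

lemma exists_polynomial_eval_eq_det_add_smul {R M : Type*} [CommRing R] [Nontrivial R]
    [AddCommGroup M] [Module R M] [Module.Free R M] [Module.Finite R M] (f g : M →ₗ[R] M) :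
    ∃ p : R[X], p.natDegree ≤ Module.finrank R M ∧ ∀ t, p.eval t = LinearMap.det (f + t • g) := by
  set b := Module.finBasis R M
  refine ⟨((X : R[X]) • (LinearMap.toMatrix b b g).map C + (LinearMap.toMatrix b b f).map C).det,
    by simpa using natDegree_det_X_add_C_le (LinearMap.toMatrix b b g) (LinearMap.toMatrix b b f),
    fun t => ?_⟩
  rw [← LinearMap.det_toMatrix b, ← coe_evalRingHom, RingHom.map_det]
  congr 1
  ext i j
  simp [add_comm ((LinearMap.toMatrix b b f) i j), mul_comm t]

lemma exists_polynomial_eval_eq_integral {α : Type*} [MeasurableSpace α] {μ : Measure α}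
    {f : ℝ → α → ℝ} {n : ℕ} (hf : ∀ t, Integrable (f t) μ)
    (hpoly : ∀ x, ∃ p : ℝ[X], p.natDegree ≤ n ∧ ∀ t, p.eval t = f t x) :
    ∃ P : ℝ[X], ∀ t, P.eval t = ∫ x, f t x ∂μ := by
  set s := Finset.range (n + 1) with hs
  set v : ℕ → ℝ := Nat.cast
  have hv : Set.InjOn v s := Nat.cast_injective.injOn
  have hinterpolate (t : ℝ) (x : α) : f t x = ∑ j ∈ s, (Lagrange.basis s v j).eval t * f j x := by
    obtain ⟨p, hp, hpf⟩ := hpoly x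
    have hdeg : p.degree < s.card := by
      rw [hs, Finset.card_range]
      exact p.degree_le_natDegree.trans_lt (by exact_mod_cast Nat.lt_succ_of_le hp)
    rw [← hpf, Lagrange.eq_interpolate_of_eval_eq (fun j => f j x) (s := s) hv hdeg fun j _ =>
      hpf j]
    simp [Lagrange.interpolate_apply, eval_finsetSum, mul_comm]
  refine ⟨∑ j ∈ s, Lagrange.basis s v j * C (∫ x, f j x ∂μ), fun t => ?_⟩
  calc _ = ∑ j ∈ s, ∫ x, (Lagrange.basis s v j).eval t * f j x ∂μ := by
        simp only [eval_finsetSum, eval_mul, eval_C, integral_const_mul]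
    _ = ∫ x, ∑ j ∈ s, (Lagrange.basis s v j).eval t * f j x ∂μ :=
        (integral_finsetSum s fun j _ => (hf j).const_mul _).symm
    _ = ∫ x, f t x ∂μ := by simp_rw [hinterpolate t]

lemma inter_frontier_nonempty_of_isPreconnected {α : Type*} [TopologicalSpace α] {s t : Set α}
    (ht : IsPreconnected t) (h : (t ∩ s).Nonempty) (h' : (t ∩ sᶜ).Nonempty) :
    (t ∩ frontier s).Nonempty := by
  rw [frontier_eq_closure_inter_closure]
  refine isPreconnected_closed_iff.1 ht _ _ isClosed_closure isClosed_closure (fun x _ => ?_)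
    (h.mono (Set.inter_subset_inter_right t subset_closure))
    (h'.mono (Set.inter_subset_inter_right t subset_closure))
  exact (em (x ∈ s)).imp (@subset_closure _ _ _ _) (@subset_closure _ _ _ _)

lemma lipschitzWith_indicator_of_eqOn_frontier {E F : Type*} [NormedAddCommGroup E]
    [NormedSpace ℝ E] [PseudoMetricSpace F] [Zero F] {s : Set E} (hs : IsClosed s) {K : NNReal}
    {f : E → F} (hf : LipschitzOnWith K f s) (hf₀ : Set.EqOn f 0 (frontier s)) :
    LipschitzWith K (s.indicator f) := by
  have hcross : ∀ x ∈ s, ∀ y ∉ s, dist (f x) 0 ≤ K * dist x y := by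
    intro x hx y hy
    obtain ⟨z, hz, hzs⟩ :=
      inter_frontier_nonempty_of_isPreconnected (convex_segment x y).isPreconnected
        ⟨x, left_mem_segment ℝ x y, hx⟩ ⟨y, right_mem_segment ℝ x y, hy⟩
    calc dist (f x) 0 = dist (f x) (f z) := by rw [hf₀ hzs, Pi.zero_apply]
      _ ≤ K * dist x z := hf.dist_le_mul x hx z (hs.frontier_subset hzs)
      _ ≤ K * dist x y := by
        gcongr
        linarith [dist_add_dist_of_mem_segment hz, dist_nonneg (x := z) (y := y)]
  refine .of_dist_le_mul fun x y => ?_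
  by_cases hx : x ∈ s <;> by_cases hy : y ∈ s <;> simp only [hx, hy, not_false_eq_true,
    Set.indicator_of_mem, Set.indicator_of_notMem]
  · exact hf.dist_le_mul x hx y hy
  · exact hcross x hx y hy
  · rw [dist_comm, dist_comm x]
    exact hcross y hy x hx
  · rw [dist_self]
    positivity

lemma bijective_add_of_lipschitzWith {E : Type*} [NormedAddCommGroup E] [NormedSpace ℝ E]
    [CompleteSpace E] {φ : E → E} {K : NNReal} (hφ : LipschitzWith K φ) (hK : K < 1) :
    Function.Bijective fun x => x + φ x := by
  have happrox : ApproximatesLinearOn (fun x => x + φ x)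
      ((ContinuousLinearEquiv.refl ℝ E : E ≃L[ℝ] E) : E →L[ℝ] E) Set.univ K := by
    refine LipschitzOnWith.approximatesLinearOn ?_
    convert hφ.lipschitzOnWith using 1
    ext x
    simp
  have hK' : Subsingleton E ∨ K < ‖((ContinuousLinearEquiv.refl ℝ E).symm : E →L[ℝ] E)‖₊⁻¹ := by
    rcases subsingleton_or_nontrivial E with h | h
    · exact .inl h
    · have hnorm : ‖((ContinuousLinearEquiv.refl ℝ E).symm : E →L[ℝ] E)‖₊ = 1 :=
        NNReal.eq ContinuousLinearMap.norm_id
      rw [hnorm, inv_one]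
      exact .inr hK
  exact ⟨Set.injOn_univ.1 (happrox.injOn hK'), happrox.surjective hK'⟩

lemma bijOn_add_of_lipschitzOnWith_of_eqOn_frontier {E : Type*} [NormedAddCommGroup E]
    [NormedSpace ℝ E] [CompleteSpace E] {s : Set E} (hs : IsClosed s) {φ : E → E} {K : NNReal}
    (hφ : LipschitzOnWith K φ s) (hK : K < 1) (hφ₀ : Set.EqOn φ 0 (frontier s)) :
    Set.BijOn (fun x => x + φ x) s s := by
  set f : E → E := fun x => x + s.indicator φ x
  have hf : Function.Bijective f :=
    bijective_add_of_lipschitzWith (lipschitzWith_indicator_of_eqOn_frontier hs hφ hφ₀) hK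
  have himage : f '' s = s := by
    have hcompl : Set.EqOn f id sᶜ := fun x hx => by simp [f, Set.indicator_of_notMem hx]
    rw [← compl_inj_iff, ← Set.image_compl_eq hf, hcompl.image_eq_self]
  have hfs : Set.EqOn f (fun x => x + φ x) s := fun x hx => by simp [f, Set.indicator_of_mem hx]
  exact (himage ▸ hf.injective.injOn.bijOn_image).congr hfs

section Volume

variable {E : Type*} [NormedAddCommGroup E] [NormedSpace ℝ E] {s : Set E} {φ : E → E}
  {φ' : E → E →L[ℝ] E}

variable (E) in
lemma eventually_det_id_add_pos :
    ∀ᶠ A : E →L[ℝ] E in 𝓝 0, 0 < (ContinuousLinearMap.id ℝ E + A).det := by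
  have hcont : Continuous fun A : E →L[ℝ] E => (ContinuousLinearMap.id ℝ E + A).det :=
    ContinuousLinearMap.continuous_det.comp (continuous_const.add continuous_id)
  refine continuous_const.continuousAt.eventually_lt hcont.continuousAt ?_
  simp [ContinuousLinearMap.det]

variable [FiniteDimensional ℝ E] [MeasurableSpace E] [BorelSpace E] (μ : Measure E)
  [μ.IsAddHaarMeasure]

lemma setIntegral_det_id_add_eq_of_lipschitzOnWith (hs : IsClosed s) {K : NNReal} (hK : K < 1)
    (hφ : LipschitzOnWith K φ s) (hφ' : ∀ x ∈ s, HasFDerivWithinAt φ (φ' x) s x)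
    (hdet : ∀ x ∈ s, 0 < (ContinuousLinearMap.id ℝ E + φ' x).det)
    (hφ₀ : Set.EqOn φ 0 (frontier s)) :
    ∫ x in s, (ContinuousLinearMap.id ℝ E + φ' x).det ∂μ = μ.real s := by
  have : CompleteSpace E := FiniteDimensional.complete ℝ E
  have hbij := bijOn_add_of_lipschitzOnWith_of_eqOn_frontier hs hφ hK hφ₀
  have hchange := integral_image_eq_integral_abs_det_fderiv_smul μ hs.measurableSet
    (fun x hx => (hasFDerivWithinAt_id x s).add (hφ' x hx)) hbij.injOn fun _ => (1 : ℝ)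
  calc ∫ x in s, (ContinuousLinearMap.id ℝ E + φ' x).det ∂μ
      = ∫ x in s, |(ContinuousLinearMap.id ℝ E + φ' x).det| • (1 : ℝ) ∂μ :=
        setIntegral_congr_fun hs.measurableSet fun x hx => by
          simp [abs_of_pos (hdet x hx)]
    _ = ∫ _ in (fun x => x + φ x) '' s, (1 : ℝ) ∂μ := hchange.symm
    _ = μ.real s := by simp [hbij.image_eq]

lemma eventually_setIntegral_det_id_add_smul_eq (hs : IsCompact s) (hconv : Convex ℝ s)
    (hφ : ∀ x ∈ s, HasFDerivWithinAt φ (φ' x) s x) (hφ' : ContinuousOn φ' s)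
    (hφ₀ : Set.EqOn φ 0 (frontier s)) :
    ∀ᶠ t : ℝ in 𝓝 0, ∫ x in s, (ContinuousLinearMap.id ℝ E + t • φ' x).det ∂μ = μ.real s := by
  obtain ⟨C, hC⟩ := hs.exists_bound_of_continuousOn hφ'
  obtain ⟨ε, hε, hdet⟩ := Metric.eventually_nhds_iff.1 (eventually_det_id_add_pos E)
  have hsmall : ∀ᶠ t : ℝ in 𝓝 0, ‖t‖ * C.toNNReal < min 1 ε :=
    (Continuous.tendsto' (by fun_prop) 0 0 (by simp)).eventually_lt_const (by positivity)
  filter_upwards [hsmall] with t ht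
  have hbound : ∀ x ∈ s, ‖t • φ' x‖ ≤ ‖t‖ * C.toNNReal := fun x hx => by
    rw [norm_smul]
    gcongr
    exact (hC x hx).trans C.le_coe_toNNReal
  have hlip : LipschitzOnWith (‖t‖₊ * C.toNNReal) (t • φ) s :=
    hconv.lipschitzOnWith_of_nnnorm_hasFDerivWithin_le
      (fun x hx => (hφ x hx).const_smul t) fun x hx => hbound x hx
  exact setIntegral_det_id_add_eq_of_lipschitzOnWith μ hs.isClosed (ht.trans_le (min_le_left 1 ε))
    hlip (fun x hx => (hφ x hx).const_smul t)
    (fun x hx => hdet (by simpa using (hbound x hx).trans_lt (ht.trans_le (min_le_right 1 ε))))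
    fun x hx => by simp [hφ₀ hx]

theorem setIntegral_det_id_add_eq (hs : IsCompact s) (hconv : Convex ℝ s)
    (hφ : ∀ x ∈ s, HasFDerivWithinAt φ (φ' x) s x) (hφ' : ContinuousOn φ' s)
    (hφ₀ : Set.EqOn φ 0 (frontier s)) :
    ∫ x in s, (ContinuousLinearMap.id ℝ E + φ' x).det ∂μ = μ.real s := by
  obtain ⟨P, hP⟩ := exists_polynomial_eval_eq_integral (μ := μ.restrict s)
    (f := fun t x => (ContinuousLinearMap.id ℝ E + t • φ' x).det)
    (fun t => (ContinuousLinearMap.continuous_det.comp_continuousOn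
      (continuousOn_const.add (hφ'.const_smul t))).integrableOn_compact hs)
    fun x => exists_polynomial_eval_eq_det_add_smul LinearMap.id (φ' x : E →ₗ[ℝ] E)
  have hP_const : P = C (μ.real s) := by
    refine eq_of_infinite_eval_eq P _ (infinite_of_mem_nhds 0 ?_)
    filter_upwards [eventually_setIntegral_det_id_add_smul_eq μ hs hconv hφ hφ' hφ₀] with t ht
    simp only [hP, ht, eval_C]
  simpa [hP_const] using (hP 1).symm

end Volume

section Sphere

variable {E : Type*} [NormedAddCommGroup E] [InnerProductSpace ℝ E] [FiniteDimensional ℝ E]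

lemma det_fderiv_eq_zero_of_norm_eq_one {g : E → E} {x : E} (hg : DifferentiableAt ℝ g x)
    (h : ∀ᶠ y in 𝓝 x, ‖g y‖ = 1) : (fderiv ℝ g x).det = 0 := by
  by_contra hdet
  have horth (v : E) : inner ℝ (g x) (fderiv ℝ g x v) = 0 := by
    have hconst : HasFDerivAt (fun y => ‖g y‖ ^ 2) (0 : E →L[ℝ] ℝ) x :=
      (hasFDerivAt_const 1 x).congr_of_eventuallyEq (h.mono fun y hy => by simp [hy])
    simpa using DFunLike.congr_fun (hg.hasFDerivAt.norm_sq.unique hconst) v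
  have hunit : IsUnit (fderiv ℝ g x : E →ₗ[ℝ] E) :=
    (LinearMap.isUnit_iff_isUnit_det _).2 (isUnit_iff_ne_zero.2 hdet)
  obtain ⟨v, hv : fderiv ℝ g x v = g x⟩ :=
    LinearMap.range_eq_top.1 ((LinearMap.isUnit_iff_range_eq_top _).1 hunit) (g x)
  simpa [hv, h.self_of_nhds] using horth v

lemma exists_ne_of_contDiff_of_norm_eq_one {g : E → E} (hg : ContDiff ℝ 1 g)
    (hnorm : ∀ x, ‖g x‖ = 1) : ∃ x, ‖x‖ = 1 ∧ g x ≠ x := by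
  by_contra! hid
  borelize E
  have hvol : ∫ x in closedBall (0 : E) 1, (ContinuousLinearMap.id ℝ E +
      (fderiv ℝ g x - ContinuousLinearMap.id ℝ E)).det = volume.real (closedBall (0 : E) 1) := by
    refine setIntegral_det_id_add_eq volume (φ := fun x => g x - x) (isCompact_closedBall 0 1)
      (convex_closedBall 0 1) (fun x _ => ?_) ?_ fun x hx => ?_
    · exact ((hg.differentiable one_ne_zero x).hasFDerivAt.sub (hasFDerivAt_id x)).hasFDerivWithinAt
    · exact ((hg.continuous_fderiv one_ne_zero).sub continuous_const).continuousOn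
    · simp [hid x (by simpa using frontier_closedBall_subset_sphere hx)]
  have hzero (x : E) : (fderiv ℝ g x).det = 0 :=
    det_fderiv_eq_zero_of_norm_eq_one (hg.differentiable one_ne_zero x) (.of_forall hnorm)
  simp only [add_sub_cancel, hzero, integral_zero] at hvol
  exact (measureReal_ne_zero_iff measure_closedBall_lt_top.ne).2
    (measure_closedBall_pos volume _ one_pos).ne' hvol.symm

open Manifold in
lemma exists_contDiff_norm_sub_lt_of_eqOn_sphere {ρ : E → E} (hρ : Continuous ρ)
    (hid : ∀ x, ‖x‖ = 1 → ρ x = x) {ε : ℝ} (hε : 0 < ε) :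
    ∃ p : E → E, ContDiff ℝ 1 p ∧ (∀ x, ‖p x - ρ x‖ < ε) ∧ ∀ x, ‖x‖ = 1 → p x = x := by
  have hconvex (x : E) : Convex ℝ {y : E | ‖x‖ = 1 → y = x} := by
    by_cases hx : ‖x‖ = 1
    · simp [hx]
    · simpa [hx] using convex_univ
  have hnear {q : E → E} {x : E} (hq : Continuous q) (hqx : q x = ρ x) :
      ∀ᶠ y in 𝓝 x, q y ∈ ball (ρ y) ε :=
    (hq.dist hρ).continuousAt.eventually_lt_const (by simpa [hqx])
  obtain ⟨p, hp⟩ := exists_contMDiffMap_forall_mem_convex_of_local (n := 1) 𝓘(ℝ, E)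
    (t := fun x => ball (ρ x) ε ∩ {y | ‖x‖ = 1 → y = x})
    (fun x => (convex_ball (ρ x) ε).inter (hconvex x)) fun x => by
      by_cases hx : ‖x‖ = 1
      · exact ⟨_, hnear continuous_id (hid x hx).symm, id, contMDiffOn_id, fun y hy =>
          ⟨hy, fun _ => rfl⟩⟩
      · have hne : ∀ᶠ y in 𝓝 x, ‖y‖ ≠ 1 := continuous_norm.continuousAt.eventually_ne hx
        exact ⟨_, (hnear continuous_const rfl).and hne, fun _ => ρ x, contMDiffOn_const,
          fun y hy => ⟨hy.1, fun h => absurd h hy.2⟩⟩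
  exact ⟨p, p.contMDiff.contDiff, fun x => mem_ball_iff_norm.1 (hp x).1, fun x => (hp x).2⟩

theorem exists_ne_of_continuous_of_norm_eq_one {ρ : E → E} (hρ : Continuous ρ)
    (hnorm : ∀ x, ‖ρ x‖ = 1) : ∃ x, ‖x‖ = 1 ∧ ρ x ≠ x := by
  by_contra! hid
  obtain ⟨p, hp, hpρ, hpid⟩ := exists_contDiff_norm_sub_lt_of_eqOn_sphere hρ hid one_pos
  have hp₀ (x : E) : p x ≠ 0 := fun h => by simpa [h, hnorm] using hpρ x
  obtain ⟨x, hx, hne⟩ := exists_ne_of_contDiff_of_norm_eq_one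
    (((hp.norm ℝ hp₀).inv fun x => norm_ne_zero_iff.2 (hp₀ x)).smul hp)
    fun x => norm_smul_inv_norm (𝕜 := ℝ) (hp₀ x)
  exact hne (by simp [hpid x hx, hx])

end Sphere

theorem not_tietzeExtension_sphere.{u} {E : Type u} [NormedAddCommGroup E] [InnerProductSpace ℝ E]
    [FiniteDimensional ℝ E] : ¬ TietzeExtension.{u, u} (sphere (0 : E) 1) := by
  intro _
  obtain ⟨ρ, hρ⟩ := ContinuousMap.exists_restrict_eq isClosed_sphere (.id (sphere (0 : E) 1))
  obtain ⟨x, hx, hne⟩ := exists_ne_of_continuous_of_norm_eq_one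
    (continuous_subtype_val.comp ρ.continuous) fun x => norm_eq_of_mem_sphere (ρ x)
  have hρx : ρ x = (⟨x, mem_sphere_zero_iff_norm.2 hx⟩ : sphere (0 : E) 1) :=
    DFunLike.congr_fun hρ ⟨x, mem_sphere_zero_iff_norm.2 hx⟩
  exact hne (congrArg Subtype.val hρx)

end NoRetraction

namespace SimpComplex

lemma not_isSpherical_of_tietzeExtension {V : Type*} [Fintype V] [DecidableEq V]
    {Δ : LowerSet (Finset V)} (_ : TietzeExtension.{0} (realization Δ)) : ¬ IsSpherical Δ :=
  fun ⟨_, ⟨e⟩⟩ => not_tietzeExtension_sphere (.of_homeo e.symm)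

end SimpComplex

namespace SubwordComplex

section Coxeter

variable {B W : Type*} [Group W] {M : CoxeterMatrix B} (cs : CoxeterSystem M W)

section StrongExchange

open Classical in
/-- The action of the simple reflection `s_i` on `W × ZMod 2`: conjugation on `W`, with a change of
sign exactly at `s_i`. It extends to an action of `W`, in which the sign change at a reflection `t`
detects whether `t` is an inversion. -/
noncomputable def signedConjFun (i : B) (p : W × ZMod 2) : W × ZMod 2 :=
  (cs.simple i * p.1 * cs.simple i, p.2 + if p.1 = cs.simple i then 1 else 0)

lemma involutive_signedConjFun (i : B) : Function.Involutive (signedConjFun cs i) := by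
  rintro ⟨t, e⟩
  have h : cs.simple i * t * cs.simple i = cs.simple i ↔ t = cs.simple i := by
    rw [mul_eq_right, mul_eq_one_iff_eq_inv', cs.inv_simple]
  ext
  · simp [signedConjFun, mul_assoc]
  · by_cases ht : t = cs.simple i
    · simp [signedConjFun, ht, add_assoc, CharTwo.add_self_eq_zero]
    · simp [signedConjFun, mt h.1 ht, ht]

/-- `signedConjFun` as a permutation. -/
noncomputable def signedConj (i : B) : Equiv.Perm (W × ZMod 2) :=
  (involutive_signedConjFun cs i).toPerm

lemma signedConj_apply (i : B) (p : W × ZMod 2) : signedConj cs i p = signedConjFun cs i p := rfl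

open Classical in
lemma prod_map_signedConj_apply (ω : List B) (t : W) (e : ZMod 2) :
    (ω.map (signedConj cs)).prod (t, e) =
      (cs.wordProd ω * t * (cs.wordProd ω)⁻¹, e + ((cs.rightInvSeq ω).count t : ZMod 2)) := by
  induction ω with
  | nil => simp
  | cons i ω ih =>
    have h : cs.wordProd ω * t * (cs.wordProd ω)⁻¹ = cs.simple i ↔
        (cs.wordProd ω)⁻¹ * cs.simple i * cs.wordProd ω = t := by
      rw [mul_inv_eq_iff_eq_mul, ← eq_inv_mul_iff_mul_eq, eq_comm, mul_assoc]
    rw [List.map_cons, List.prod_cons, Equiv.Perm.mul_apply, ih]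
    simp only [signedConj_apply, signedConjFun, CoxeterSystem.rightInvSeq, List.count_cons,
      cs.wordProd_cons, h, beq_iff_eq]
    ext
    · simp [mul_assoc]
    · push_cast
      rw [add_assoc]

lemma leftInvSeq_alternatingWord_two_mul (i j : B) :
    ∃ l, cs.leftInvSeq (CoxeterSystem.alternatingWord i j (2 * M i j)) = l ++ l := by
  set ω := cs.leftInvSeq (CoxeterSystem.alternatingWord i j (2 * M i j)) with hω
  have hlen : ω.length = 2 * M i j := by simp [hω]
  refine ⟨ω.take (M i j), ?_⟩
  conv_lhs => rw [← List.take_append_drop (M i j) ω]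
  congr 1
  refine List.ext_getElem (by simp [hlen]; omega) fun k h₁ h₂ => ?_
  simp only [List.length_drop, List.length_take, hlen] at h₁ h₂
  rw [List.getElem_drop, List.getElem_take]
  simp only [hω]
  rw [cs.getElem_leftInvSeq_alternatingWord i j _ _ (by omega),
    cs.getElem_leftInvSeq_alternatingWord i j _ _ (by omega),
    CoxeterSystem.prod_alternatingWord_eq_mul_pow, CoxeterSystem.prod_alternatingWord_eq_mul_pow,
    show (2 * (M i j + k) + 1) / 2 = M i j + k by omega, show (2 * k + 1) / 2 = k by omega,
    pow_add, M.symmetric i j, cs.simple_mul_simple_pow j i]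
  simp

lemma prod_map_alternatingWord_two_mul {G : Type*} [Monoid G] (f : B → G) (i j : B) (m : ℕ) :
    ((CoxeterSystem.alternatingWord i j (2 * m)).map f).prod = (f i * f j) ^ m := by
  induction m with
  | zero => simp [CoxeterSystem.alternatingWord]
  | succ m ih =>
    rw [show 2 * (m + 1) = 2 * m + 1 + 1 by ring, CoxeterSystem.alternatingWord_succ,
      CoxeterSystem.alternatingWord_succ]
    simp [ih, pow_succ]

lemma isLiftable_signedConj : M.IsLiftable (signedConj cs) := by
  classical
  intro i j
  rw [← prod_map_alternatingWord_two_mul]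
  set ω := CoxeterSystem.alternatingWord i j (2 * M i j) with hω
  have hrev : (ω.reverse.map (signedConj cs)).prod = ((ω.map (signedConj cs)).prod)⁻¹ := by
    rw [List.prod_inv_reverse, List.map_map, List.map_reverse]
    congr 3
  have hone : cs.wordProd ω = 1 := by
    rw [CoxeterSystem.wordProd, hω, prod_map_alternatingWord_two_mul, cs.simple_mul_simple_pow]
  rw [← inv_eq_one, ← hrev]
  ext1 ⟨t, e⟩
  obtain ⟨l, hl⟩ := leftInvSeq_alternatingWord_two_mul cs i j
  rw [prod_map_signedConj_apply, cs.rightInvSeq_reverse, cs.wordProd_reverse, hone, hl]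
  simp [CharTwo.add_self_eq_zero]

/-- The action of `W` on `W × ZMod 2` extending `signedConj`. -/
noncomputable def signedConjHom : W →* Equiv.Perm (W × ZMod 2) :=
  cs.lift ⟨signedConj cs, isLiftable_signedConj cs⟩

lemma signedConjHom_wordProd (ω : List B) :
    signedConjHom cs (cs.wordProd ω) = (ω.map (signedConj cs)).prod := by
  rw [CoxeterSystem.wordProd, map_list_prod, List.map_map]
  congr 2
  ext1 i
  exact cs.lift_apply_simple (isLiftable_signedConj cs) i

lemma signedConjHom_apply (w t : W) (e : ZMod 2) :
    signedConjHom cs w (t, e) = (w * t * w⁻¹, e + (signedConjHom cs w (t, 0)).2) := by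
  classical
  obtain ⟨ω, -, rfl⟩ := cs.exists_isReduced w
  simp only [signedConjHom_wordProd, prod_map_signedConj_apply, zero_add]

lemma signedConjHom_simple_self (i : B) (e : ZMod 2) :
    signedConjHom cs (cs.simple i) (cs.simple i, e) = (cs.simple i, e + 1) := by
  rw [← cs.wordProd_singleton, signedConjHom_wordProd]
  simp [signedConj_apply, signedConjFun]

lemma signedConjHom_self {t : W} (ht : cs.IsReflection t) :
    signedConjHom cs t (t, 0) = (t, 1) := by
  obtain ⟨u, i, rfl⟩ := ht
  set x := u * cs.simple i * u⁻¹ with hx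
  set a := (signedConjHom cs u⁻¹ (x, 0)).2 with ha
  have h_inv : signedConjHom cs u⁻¹ (x, 0) = (cs.simple i, a) := by
    rw [signedConjHom_apply, ← ha]
    simp [hx, mul_assoc]
  have h_zero : signedConjHom cs u (cs.simple i, a) = (x, 0) := by
    rw [← h_inv, ← Equiv.Perm.mul_apply, ← map_mul]; simp
  have h_one : signedConjHom cs u (cs.simple i, a + 1) = (x, 1) := by
    rw [signedConjHom_apply, Prod.mk.injEq] at h_zero ⊢
    rw [add_right_comm, h_zero.2, zero_add]
    exact ⟨h_zero.1, rfl⟩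
  conv_lhs => rw [hx, map_mul, map_mul, Equiv.Perm.mul_apply, Equiv.Perm.mul_apply, ← hx, h_inv,
    signedConjHom_simple_self, h_one]

lemma mem_rightInvSeq_of_signedConjHom {ω : List B} {t : W}
    (h : (signedConjHom cs (cs.wordProd ω) (t, 0)).2 ≠ 0) : t ∈ cs.rightInvSeq ω := by
  classical
  by_contra hmem
  rw [signedConjHom_wordProd, prod_map_signedConj_apply, List.count_eq_zero_of_not_mem hmem] at h
  simp at h

theorem mem_rightInvSeq_of_isRightInversion {ω : List B} {t : W}
    (h : cs.IsRightInversion (cs.wordProd ω) t) : t ∈ cs.rightInvSeq ω := by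
  apply mem_rightInvSeq_of_signedConjHom
  intro h_zero
  obtain ⟨ω', hred, hω'⟩ := cs.exists_isReduced (cs.wordProd ω * t)
  have hmem : t ∈ cs.rightInvSeq ω' := by
    apply mem_rightInvSeq_of_signedConjHom
    rw [← hω', map_mul, Equiv.Perm.mul_apply, signedConjHom_self cs h.1, signedConjHom_apply,
      h_zero]
    simp
  have hlt := (cs.isRightInversion_of_mem_rightInvSeq hred hmem).2
  rw [← hω', mul_assoc, h.1.mul_self, mul_one] at hlt
  exact lt_asymm hlt h.2

theorem exists_eraseIdx_of_isRightInversion {ω : List B} {t : W}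
    (h : cs.IsRightInversion (cs.wordProd ω) t) :
    ∃ j < ω.length, cs.wordProd ω * t = cs.wordProd (ω.eraseIdx j) := by
  obtain ⟨j, hj, rfl⟩ := List.mem_iff_getElem.1 (mem_rightInvSeq_of_isRightInversion cs h)
  refine ⟨j, by simpa using hj, ?_⟩
  rw [← List.getD_eq_getElem _ 1 hj, cs.wordProd_mul_getD_rightInvSeq]

theorem exists_eraseIdx_of_isLeftDescent {ω : List B} {i : B}
    (h : cs.IsLeftDescent (cs.wordProd ω) i) :
    ∃ j < ω.length, cs.simple i * cs.wordProd ω = cs.wordProd (ω.eraseIdx j) := by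
  have hconj : cs.wordProd ω * ((cs.wordProd ω)⁻¹ * cs.simple i * cs.wordProd ω) =
      cs.simple i * cs.wordProd ω := by group
  rw [← hconj]
  refine exists_eraseIdx_of_isRightInversion cs ⟨⟨(cs.wordProd ω)⁻¹, i, by simp⟩, ?_⟩
  rw [hconj]
  exact h

end StrongExchange

section Reflections

variable {cs}

lemma simple_mul_eq_mul_reflection {x t : W} {i : B} (ht : cs.IsReflection t)
    (hx : cs.length x < cs.length (cs.simple i * x)) (hxt : cs.length x < cs.length (x * t))
    (h : cs.length (cs.simple i * x * t) < cs.length (cs.simple i * x)) :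
    cs.simple i * x = x * t := by
  obtain ⟨ω, hred, rfl⟩ := cs.exists_isReduced x
  rw [← cs.wordProd_cons] at h ⊢
  obtain ⟨j, hj, he⟩ := exists_eraseIdx_of_isRightInversion cs ⟨ht, h⟩
  rw [cs.wordProd_cons] at he ⊢
  rcases j with _ | j
  · rw [List.eraseIdx_cons_zero] at he
    nth_rw 2 [← he]
    rw [mul_assoc _ t, ht.mul_self, mul_one]
  · rw [List.eraseIdx_cons_succ, cs.wordProd_cons, mul_assoc] at he
    have hle := cs.length_wordProd_le (ω.eraseIdx j)
    rw [← mul_left_cancel he, List.length_eraseIdx_of_lt (by simpa using hj)] at hle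
    have : cs.length (cs.wordProd ω) = ω.length := hred
    omega

lemma mul_reflection_eq_mul_simple {u r : W} {i : B} (hr : cs.IsReflection r)
    (hu : cs.length u < cs.length (u * cs.simple i)) (hur : cs.length u < cs.length (u * r))
    (h : cs.length (u * r * cs.simple i) < cs.length (u * cs.simple i)) :
    u * r = u * cs.simple i := by
  have hright : u⁻¹ * (u * r * u⁻¹) = (u * r)⁻¹ := by simp [hr.inv, mul_assoc]
  have hleft : cs.simple i * u⁻¹ = (u * cs.simple i)⁻¹ := by simp
  have hboth : cs.simple i * u⁻¹ * (u * r * u⁻¹) = (u * r * cs.simple i)⁻¹ := by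
    simp [hr.inv, mul_assoc]
  have heq := simple_mul_eq_mul_reflection (x := u⁻¹) (i := i) (hr.conj u)
    (by rwa [hleft, cs.length_inv, cs.length_inv]) (by rwa [hright, cs.length_inv, cs.length_inv])
    (by rwa [hboth, hleft, cs.length_inv, cs.length_inv])
  rw [hright, hleft] at heq
  exact (inv_injective heq).symm

lemma exists_eraseIdx_of_mul_reflection {u r : W} (hr : cs.IsReflection r) {z : List B}
    (hz : cs.length (u * cs.wordProd z) = cs.length u + z.length)
    (hur : cs.length (u * r) = cs.length u + 1)
    (h : cs.length (u * r * cs.wordProd z) < cs.length (u * r) + z.length) :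
    ∃ j < z.length, u * r * cs.wordProd (z.eraseIdx j) = u * cs.wordProd z := by
  induction z generalizing u r with
  | nil => simp at h
  | cons k z ih =>
    simp only [cs.wordProd_cons, ← mul_assoc, List.length_cons] at hz h ⊢
    have huk : cs.length (u * cs.simple k) = cs.length u + 1 := by
      have := cs.length_mul_le (u * cs.simple k) (cs.wordProd z)
      have := cs.length_wordProd_le z
      rcases cs.length_mul_simple u k with hk | hk <;> omega
    rcases cs.length_mul_simple (u * r) k with hk | hk
    · have hconj : u * cs.simple k * (cs.simple k * r * cs.simple k) = u * r * cs.simple k := by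
        simp [mul_assoc]
      have hrefl : cs.IsReflection (cs.simple k * r * cs.simple k) := by
        simpa using hr.conj (cs.simple k)
      obtain ⟨j, hj, he⟩ := ih (u := u * cs.simple k) hrefl (by omega)
        (by rw [hconj]; omega) (by rw [hconj]; omega)
      rw [hconj] at he
      exact ⟨j + 1, by omega, by simpa [cs.wordProd_cons, ← mul_assoc] using he⟩
    · have heq := mul_reflection_eq_mul_simple (u := u) (i := k) hr (by omega) (by omega) (by omega)
      exact ⟨0, by omega, by rw [List.eraseIdx_cons_zero, heq]⟩

end Reflections

section Bruhat

/-- The generating relation of the Bruhat order: right multiplication by a reflection that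
increases the length. -/
def BruhatStep (x y : W) : Prop :=
  ∃ t, cs.IsReflection t ∧ y = x * t ∧ cs.length x < cs.length y

/-- The Bruhat order on `W`. -/
def BruhatLE : W → W → Prop := Relation.ReflTransGen (BruhatStep cs)

variable {cs}

lemma BruhatLE.length_le {x y : W} (h : BruhatLE cs x y) : cs.length x ≤ cs.length y := by
  induction h with
  | refl => rfl
  | tail _ hs ih =>
    obtain ⟨t, -, -, hlt⟩ := hs
    exact ih.trans hlt.le

lemma bruhatLE_simple_mul {x : W} {i : B} (h : cs.length x < cs.length (cs.simple i * x)) :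
    BruhatLE cs x (cs.simple i * x) :=
  .single ⟨x⁻¹ * cs.simple i * x, ⟨x⁻¹, i, by simp⟩, by group, h⟩

lemma BruhatStep.simple_mul {x y : W} (h : BruhatStep cs x y) (i : B) :
    BruhatLE cs (cs.simple i * x) y ∨ BruhatLE cs (cs.simple i * x) (cs.simple i * y) := by
  obtain ⟨t, ht, rfl, hlt⟩ := id h
  rcases lt_or_gt_of_ne (cs.length_simple_mul_ne x i) with hdesc | hasc
  · left
    have hup : BruhatLE cs (cs.simple i * x) x := by
      simpa using bruhatLE_simple_mul (cs := cs) (x := cs.simple i * x) (i := i)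
        (by simpa using hdesc)
    exact hup.tail h
  rcases lt_or_gt_of_ne (ht.length_mul_left_ne (cs.simple i * x)) with hdown | hup
  · left
    rw [simple_mul_eq_mul_reflection ht hasc hlt hdown]
    exact .refl
  · right
    exact .single ⟨t, ht, by group, by rwa [← mul_assoc]⟩

lemma BruhatLE.simple_mul {x y : W} (h : BruhatLE cs x y) (i : B) :
    BruhatLE cs (cs.simple i * x) y ∨ BruhatLE cs (cs.simple i * x) (cs.simple i * y) := by
  induction h using Relation.ReflTransGen.head_induction_on with
  | refl => exact Or.inr .refl
  | head hs hle ih =>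
    rcases hs.simple_mul i with h | h
    · exact Or.inl (h.trans hle)
    · exact ih.imp h.trans h.trans

end Bruhat

section Demazure

/-- The Demazure product of a word, the largest element in the Bruhat order that has a reduced
expression which is a subword. -/
noncomputable def demazureProduct : List B → W
  | [] => 1
  | i :: ω =>
    if cs.length (demazureProduct ω) < cs.length (cs.simple i * demazureProduct ω) then
      cs.simple i * demazureProduct ω
    else demazureProduct ω

variable {cs}

lemma demazureProduct_cons_of_ascent {ω : List B} {i : B}
    (h : cs.length (demazureProduct cs ω) < cs.length (cs.simple i * demazureProduct cs ω)) :
    demazureProduct cs (i :: ω) = cs.simple i * demazureProduct cs ω := if_pos h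

lemma demazureProduct_cons_of_descent {ω : List B} {i : B}
    (h : cs.length (cs.simple i * demazureProduct cs ω) < cs.length (demazureProduct cs ω)) :
    demazureProduct cs (i :: ω) = demazureProduct cs ω := if_neg h.le.not_gt

lemma bruhatLE_demazureProduct_cons (i : B) (ω : List B) :
    BruhatLE cs (demazureProduct cs ω) (demazureProduct cs (i :: ω)) ∧
      BruhatLE cs (cs.simple i * demazureProduct cs ω) (demazureProduct cs (i :: ω)) := by
  rcases lt_or_gt_of_ne (cs.length_simple_mul_ne (demazureProduct cs ω) i) with h | h
  · rw [demazureProduct_cons_of_descent h]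
    refine ⟨.refl, ?_⟩
    simpa using bruhatLE_simple_mul (cs := cs) (x := cs.simple i * demazureProduct cs ω) (i := i)
      (by simpa using h)
  · rw [demazureProduct_cons_of_ascent h]
    exact ⟨bruhatLE_simple_mul h, .refl⟩

lemma ne_demazureProduct_of_ne_demazureProduct_cons {ω : List B} {i : B} {w : W}
    (hw : cs.length (cs.simple i * w) < cs.length w) (hne : w ≠ demazureProduct cs (i :: ω)) :
    cs.simple i * w ≠ demazureProduct cs ω ∧ w ≠ demazureProduct cs ω := by
  rcases lt_or_gt_of_ne (cs.length_simple_mul_ne (demazureProduct cs ω) i) with h | h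
  · rw [demazureProduct_cons_of_descent h] at hne
    refine ⟨fun heq => ?_, hne⟩
    rw [← heq, cs.simple_mul_simple_cancel_left] at h
    exact lt_asymm h hw
  · rw [demazureProduct_cons_of_ascent h] at hne
    refine ⟨fun heq => hne (by rw [← heq, cs.simple_mul_simple_cancel_left]), fun heq => ?_⟩
    rw [← heq] at h
    exact lt_asymm h hw

end Demazure

variable {V : Type*} (Q : V → B)

section ReducedSubwords

/-- `c` is a subword of `L` whose letters form a reduced expression of `w`. Here and below the
entries of a list are positions, and `Q` assigns to each position its letter. -/
structure IsReducedSubword (L : List V) (w : W) (c : List V) : Prop where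
  sublist : c.Sublist L
  prod_eq : cs.wordProd (c.map Q) = w
  length_eq : c.length = cs.length w

variable {cs Q} {L c : List V} {w : W} {v : V}

lemma IsReducedSubword.cons (h : IsReducedSubword cs Q L w c) :
    IsReducedSubword cs Q (v :: L) w c := ⟨h.sublist.cons v, h.prod_eq, h.length_eq⟩

lemma IsReducedSubword.cons_cons (h : IsReducedSubword cs Q L (cs.simple (Q v) * w) c)
    (hw : cs.length (cs.simple (Q v) * w) < cs.length w) :
    IsReducedSubword cs Q (v :: L) w (v :: c) := by
  refine ⟨h.sublist.cons_cons v, by simp [cs.wordProd_cons, h.prod_eq], ?_⟩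
  have := h.length_eq
  rw [List.length_cons]
  rcases cs.length_simple_mul w (Q v) with h | h <;> omega

lemma IsReducedSubword.of_cons (h : IsReducedSubword cs Q (v :: L) w c) :
    IsReducedSubword cs Q L w c ∨ cs.length (cs.simple (Q v) * w) < cs.length w ∧
      ∃ c', c = v :: c' ∧ IsReducedSubword cs Q L (cs.simple (Q v) * w) c' := by
  rcases List.sublist_cons_iff.1 h.sublist with hL | ⟨c', rfl, hL⟩
  · exact Or.inl ⟨hL, h.prod_eq, h.length_eq⟩
  · right
    have hprod : cs.wordProd (c'.map Q) = cs.simple (Q v) * w := by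
      simp [← h.prod_eq, cs.wordProd_cons]
    have hle := cs.length_wordProd_le (c'.map Q)
    have hlen := h.length_eq
    rw [hprod, List.length_map] at hle
    rw [List.length_cons] at hlen
    refine ⟨by omega, c', rfl, hL, hprod, ?_⟩
    rcases cs.length_simple_mul w (Q v) with h | h <;> omega

lemma IsReducedSubword.exists_of_descent (h : IsReducedSubword cs Q L w c) {i : B}
    (hw : cs.length (cs.simple i * w) < cs.length w) :
    ∃ c', c'.Sublist c ∧ IsReducedSubword cs Q L (cs.simple i * w) c' := by
  obtain ⟨j, hj, he⟩ := exists_eraseIdx_of_isLeftDescent cs (ω := c.map Q) (i := i)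
    (by rw [h.prod_eq]; exact hw)
  rw [List.length_map] at hj
  rw [h.prod_eq] at he
  refine ⟨c.eraseIdx j, List.eraseIdx_sublist _ _, (List.eraseIdx_sublist _ _).trans h.sublist,
    by rw [he, List.eraseIdx_map], ?_⟩
  have := h.length_eq
  rw [List.length_eraseIdx_of_lt hj]
  rcases cs.length_simple_mul w i with h | h <;> omega

lemma isReducedSubword_nil_iff : IsReducedSubword cs Q [] w c ↔ w = 1 ∧ c = [] := by
  constructor
  · rintro ⟨hL, hprod, -⟩
    obtain rfl := List.sublist_nil.1 hL
    simpa [eq_comm] using hprod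
  · rintro ⟨rfl, rfl⟩
    exact ⟨.refl _, by simp, by simp⟩

lemma IsReducedSubword.bruhatLE_demazureProduct (h : IsReducedSubword cs Q L w c) :
    BruhatLE cs w (demazureProduct cs (L.map Q)) := by
  induction L generalizing w c with
  | nil =>
    rw [(isReducedSubword_nil_iff.1 h).1]
    exact .refl
  | cons v L ih =>
    obtain ⟨hle, hle_mul⟩ := bruhatLE_demazureProduct_cons (cs := cs) (Q v) (L.map Q)
    rcases h.of_cons with h | ⟨-, c', -, h⟩
    · exact (ih h).trans hle
    · have hlift := (ih h).simple_mul (Q v)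
      rw [cs.simple_mul_simple_cancel_left] at hlift
      exact hlift.elim (·.trans hle) (·.trans hle_mul)

lemma IsReducedSubword.length_le_demazureProduct (h : IsReducedSubword cs Q L w c) :
    cs.length w ≤ cs.length (demazureProduct cs (L.map Q)) :=
  h.bruhatLE_demazureProduct.length_le

end ReducedSubwords

section Factorization

/-- `a` and `c` are subwords of `A` and `C` whose letters, with an element `m` in between, give a
length-additive factorization of `w`. For `m = 1` these are the reduced subwords of `A ++ C`; the
middle factor collects the letters that deletions force into every factorization. -/
structure IsFactorization (A : List V) (m : W) (C : List V) (w : W) (a c : List V) : Prop where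
  left : a.Sublist A
  right : c.Sublist C
  prod_eq : cs.wordProd (a.map Q) * m * cs.wordProd (c.map Q) = w
  length_eq : a.length + cs.length m + c.length = cs.length w

/-- `w` has a factorization with middle factor `m`, and no element with such a factorization is
longer than `w`. -/
structure IsLongestProduct (A : List V) (m : W) (C : List V) (w : W) : Prop where
  exists_isFactorization : ∃ a c, IsFactorization cs Q A m C w a c
  length_le : ∀ w' a c, IsFactorization cs Q A m C w' a c → cs.length w' ≤ cs.length w

variable {cs Q} {A C a c : List V} {m w : W} {v : V}

lemma isFactorization_one_iff :
    IsFactorization cs Q A 1 C w a c ↔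
      a.Sublist A ∧ c.Sublist C ∧ IsReducedSubword cs Q (A ++ C) w (a ++ c) := by
  constructor
  · rintro ⟨hA, hC, hprod, hlen⟩
    refine ⟨hA, hC, hA.append hC, ?_, ?_⟩
    · simpa [cs.wordProd_append] using hprod
    · simpa using hlen
  · rintro ⟨hA, hC, -, hprod, hlen⟩
    exact ⟨hA, hC, by simpa [cs.wordProd_append] using hprod, by simpa using hlen⟩

lemma IsFactorization.reverse (h : IsFactorization cs Q A m C w a c) :
    IsFactorization cs Q C.reverse m⁻¹ A.reverse w⁻¹ c.reverse a.reverse where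
  left := h.right.reverse
  right := h.left.reverse
  prod_eq := by simp [← h.prod_eq, List.map_reverse, cs.wordProd_reverse, mul_assoc]
  length_eq := by
    simp only [List.length_reverse, cs.length_inv, ← h.length_eq]
    omega

lemma IsFactorization.length_left (h : IsFactorization cs Q A m C w a c) :
    cs.length (cs.wordProd (a.map Q) * m) = a.length + cs.length m := by
  have h_mul := cs.length_mul_le (cs.wordProd (a.map Q) * m) (cs.wordProd (c.map Q))
  have h_left := cs.length_mul_le (cs.wordProd (a.map Q)) m
  have ha := cs.length_wordProd_le (a.map Q)
  have hc := cs.length_wordProd_le (c.map Q)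
  rw [h.prod_eq, ← h.length_eq] at h_mul
  rw [List.length_map] at ha hc
  omega

lemma IsFactorization.cons (h : IsFactorization cs Q A m C w a c) :
    IsFactorization cs Q A m (v :: C) w a c := ⟨h.left, h.right.cons v, h.prod_eq, h.length_eq⟩

lemma IsFactorization.cons_cons (h : IsFactorization cs Q A (m * cs.simple (Q v)) C w a c)
    (hm : cs.length m < cs.length (m * cs.simple (Q v))) :
    IsFactorization cs Q A m (v :: C) w a (v :: c) := by
  refine ⟨h.left, h.right.cons_cons v, ?_, ?_⟩
  · simp only [← h.prod_eq, List.map_cons, cs.wordProd_cons, mul_assoc]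
  · have := h.length_eq
    rw [List.length_cons]
    rcases cs.length_mul_simple m (Q v) with h | h <;> omega

lemma IsFactorization.of_cons_cons (h : IsFactorization cs Q A m (v :: C) w a (v :: c))
    (hc : c.Sublist C) : cs.length m < cs.length (m * cs.simple (Q v)) ∧
      IsFactorization cs Q A (m * cs.simple (Q v)) C w a c := by
  have hprod : cs.wordProd (a.map Q) * (m * cs.simple (Q v)) * cs.wordProd (c.map Q) = w := by
    simp only [← h.prod_eq, List.map_cons, cs.wordProd_cons, mul_assoc]
  have hlen := h.length_eq
  have h_mul := cs.length_mul_le (cs.wordProd (a.map Q) * (m * cs.simple (Q v)))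
    (cs.wordProd (c.map Q))
  have h_left := cs.length_mul_le (cs.wordProd (a.map Q)) (m * cs.simple (Q v))
  have ha := cs.length_wordProd_le (a.map Q)
  have hc' := cs.length_wordProd_le (c.map Q)
  rw [List.length_map] at ha hc'
  rw [hprod] at h_mul
  rw [List.length_cons] at hlen
  refine ⟨by omega, h.left, hc, hprod, ?_⟩
  rcases cs.length_mul_simple m (Q v) with h | h <;> omega

lemma IsFactorization.exists_eraseIdx_right (h : IsFactorization cs Q A m C w a c) {i : B}
    (hm : cs.length m < cs.length (m * cs.simple i))
    (hleft : cs.length (cs.wordProd (a.map Q) * m) <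
      cs.length (cs.wordProd (a.map Q) * m * cs.simple i))
    (hlt : cs.length (cs.wordProd (a.map Q) * m * cs.simple i * cs.wordProd (c.map Q)) <
      cs.length (cs.wordProd (a.map Q) * m * cs.simple i) + c.length) :
    ∃ j < c.length, IsFactorization cs Q A (m * cs.simple i) C w a (c.eraseIdx j) := by
  have hlen := h.length_eq
  obtain ⟨j, hj, he⟩ := exists_eraseIdx_of_mul_reflection (cs.isReflection_simple i)
    (u := cs.wordProd (a.map Q) * m) (z := c.map Q)
    (by rw [h.prod_eq, h.length_left, List.length_map, hlen])
    (by rcases cs.length_mul_simple (cs.wordProd (a.map Q) * m) i with h | h <;> omega)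
    (by rwa [List.length_map])
  rw [List.length_map] at hj
  refine ⟨j, hj, h.left, (List.eraseIdx_sublist _ _).trans h.right, ?_, ?_⟩
  · rw [← h.prod_eq, ← he, List.eraseIdx_map, mul_assoc _ m]
  · rw [List.length_eraseIdx_of_lt hj]
    rcases cs.length_mul_simple m i with h | h <;> omega

lemma IsFactorization.exists_eraseIdx_left (h : IsFactorization cs Q A m C w a c) {i : B}
    (hm : cs.length m < cs.length (m * cs.simple i))
    (hleft : cs.length (cs.wordProd (a.map Q) * m * cs.simple i) <
      cs.length (cs.wordProd (a.map Q) * m)) :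
    ∃ j < a.length, IsFactorization cs Q A (m * cs.simple i) C w (a.eraseIdx j) c := by
  obtain ⟨μ, hred, rfl⟩ := cs.exists_isReduced m
  have hμ : cs.length (cs.wordProd μ) = μ.length := hred
  rw [← cs.wordProd_append] at hleft
  obtain ⟨j, hj, he⟩ := exists_eraseIdx_of_isRightInversion cs ⟨cs.isReflection_simple i, hleft⟩
  rw [List.length_append, List.length_map] at hj
  rw [cs.wordProd_append] at he
  rcases Nat.lt_or_ge j a.length with hja | hja
  · rw [List.eraseIdx_append_of_lt_length (by simpa using hja), cs.wordProd_append] at he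
    refine ⟨j, hja, (List.eraseIdx_sublist _ _).trans h.left, h.right, ?_, ?_⟩
    · rw [← h.prod_eq, ← List.eraseIdx_map, ← mul_assoc, ← he]
      simp
    · have := h.length_eq
      rw [List.length_eraseIdx_of_lt hja]
      rcases cs.length_mul_simple (cs.wordProd μ) i with h | h <;> omega
  · rw [List.eraseIdx_append_of_length_le (by simpa using hja), cs.wordProd_append,
      mul_assoc] at he
    have hle := cs.length_wordProd_le (μ.eraseIdx (j - (a.map Q).length))
    rw [← mul_left_cancel he, List.length_eraseIdx_of_lt (by simp; omega)] at hle
    omega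

lemma IsLongestProduct.reverse (h : IsLongestProduct cs Q A m C w) :
    IsLongestProduct cs Q C.reverse m⁻¹ A.reverse w⁻¹ where
  exists_isFactorization := by
    obtain ⟨a, c, hac⟩ := h.exists_isFactorization
    exact ⟨_, _, hac.reverse⟩
  length_le w' a c hac := by
    simpa using h.length_le w'⁻¹ c.reverse a.reverse (by simpa using hac.reverse)

lemma IsLongestProduct.of_cons (h : IsLongestProduct cs Q A m (v :: C) w)
    (hac : ∃ a c, IsFactorization cs Q A m C w a c) : IsLongestProduct cs Q A m C w :=
  ⟨hac, fun w' a c hac => h.length_le w' a c hac.cons⟩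

lemma IsLongestProduct.of_cons_of_ascent (h : IsLongestProduct cs Q A m (v :: C) w)
    (hm : cs.length m < cs.length (m * cs.simple (Q v)))
    (hac : ∃ a c, IsFactorization cs Q A (m * cs.simple (Q v)) C w a c) :
    IsLongestProduct cs Q A (m * cs.simple (Q v)) C w :=
  ⟨hac, fun w' a c hac => h.length_le w' a (v :: c) (hac.cons_cons hm)⟩

lemma IsLongestProduct.exists_isFactorization_of_ascent
    (hw : IsLongestProduct cs Q A m (v :: C) w)
    (hm : cs.length m < cs.length (m * cs.simple (Q v)))
    (h : IsFactorization cs Q A m C w a c) :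
    ∃ a' c', a'.Sublist a ∧ c'.Sublist c ∧
      IsFactorization cs Q A (m * cs.simple (Q v)) C w a' c' := by
  rcases lt_or_gt_of_ne (cs.length_mul_simple_ne (cs.wordProd (a.map Q) * m) (Q v))
    with hleft | hleft
  · obtain ⟨j, -, hj⟩ := h.exists_eraseIdx_left hm hleft
    exact ⟨_, _, List.eraseIdx_sublist _ _, .refl _, hj⟩
  · suffices hlt : cs.length
        (cs.wordProd (a.map Q) * m * cs.simple (Q v) * cs.wordProd (c.map Q)) <
          cs.length (cs.wordProd (a.map Q) * m * cs.simple (Q v)) + c.length by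
      obtain ⟨j, -, hj⟩ := h.exists_eraseIdx_right hm hleft hlt
      exact ⟨_, _, .refl _, List.eraseIdx_sublist _ _, hj⟩
    by_contra! hge
    have h_mul := cs.length_mul_le (cs.wordProd (a.map Q) * m * cs.simple (Q v))
      (cs.wordProd (c.map Q))
    have hc := cs.length_wordProd_le (c.map Q)
    rw [List.length_map] at hc
    have hlen := h.length_eq
    have hlen_left := h.length_left
    have hup := cs.length_mul_simple (cs.wordProd (a.map Q) * m) (Q v)
    have hlonger : IsFactorization cs Q A m (v :: C) _ a (v :: c) :=
      ⟨h.left, h.right.cons_cons v, rfl, by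
        rw [List.map_cons, cs.wordProd_cons, ← mul_assoc, List.length_cons]
        omega⟩
    have hle := hw.length_le _ _ _ hlonger
    rw [← hlonger.length_eq, List.length_cons] at hle
    omega

end Factorization

end Coxeter

section Complexes

open SimpComplex

lemma deletion_singleton_eq_self {V : Type*} {Δ : LowerSet (Finset V)} {v : V} (h : {v} ∉ Δ) :
    deletion Δ {v} = Δ := by
  ext J
  exact ⟨fun hJ => hJ.1, fun hJ => ⟨hJ, fun hv => h (Δ.lower hv hJ)⟩⟩

lemma mem_deletion_singleton {V : Type*} {Δ : LowerSet (Finset V)} {v : V} {J : Finset V} :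
    J ∈ deletion Δ {v} ↔ J ∈ Δ ∧ v ∉ J :=
  and_congr_right fun _ => by rw [Finset.singleton_subset_iff]

variable {B W V : Type*} [Group W] {M : CoxeterMatrix B} (cs : CoxeterSystem M W) (Q : V → B)
  [DecidableEq V]

/-- The complex of all sets of letters of `A` and `C` that are avoided by some length-additive
factorization of `w` with middle factor `m`. The links and deletions of a subword complex at
successive letters are of this form. -/
def factorizationComplex (A : List V) (m : W) (C : List V) (w : W) : LowerSet (Finset V) where
  carrier := {J | J ⊆ (A ++ C).toFinset ∧
    ∃ a c, IsFactorization cs Q A m C w a c ∧ ∀ v ∈ J, v ∉ a ++ c}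
  lower' := fun _ _ hba ⟨hJ, a, c, h, hav⟩ => ⟨hba.trans hJ, a, c, h, fun v hv => hav v (hba hv)⟩

variable {cs Q} {A C a c : List V} {m w : W} {v : V} {J : Finset V}

lemma mem_factorizationComplex :
    J ∈ factorizationComplex cs Q A m C w ↔ J ⊆ (A ++ C).toFinset ∧
      ∃ a c, IsFactorization cs Q A m C w a c ∧ ∀ v ∈ J, v ∉ a ++ c := Iff.rfl

lemma empty_mem_factorizationComplex :
    ∅ ∈ factorizationComplex cs Q A m C w ↔ ∃ a c, IsFactorization cs Q A m C w a c := by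
  simp [mem_factorizationComplex]

lemma factorizationComplex_reverse_le :
    factorizationComplex cs Q C.reverse m⁻¹ A.reverse w⁻¹ ≤ factorizationComplex cs Q A m C w := by
  rintro J ⟨hJ, a, c, h, hav⟩
  refine ⟨fun v hv => ?_, c.reverse, a.reverse, by simpa using h.reverse, fun v hv => ?_⟩
  · simpa [or_comm] using hJ hv
  · simpa [and_comm] using hav v hv

lemma factorizationComplex_reverse :
    factorizationComplex cs Q C.reverse m⁻¹ A.reverse w⁻¹ = factorizationComplex cs Q A m C w :=
  factorizationComplex_reverse_le.antisymm <| by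
    simpa using factorizationComplex_reverse_le (cs := cs) (Q := Q) (A := C.reverse) (m := m⁻¹)
      (C := A.reverse) (w := w⁻¹)

lemma card_of_isFacet_factorizationComplex (hnd : (A ++ C).Nodup) {F : Finset V}
    (hF : IsFacet (factorizationComplex cs Q A m C w) F) :
    F.card = (A ++ C).length - (cs.length w - cs.length m) := by
  obtain ⟨⟨hsub, a, c, h, hav⟩, hmax⟩ := hF
  have hac : (a ++ c).Sublist (A ++ C) := h.left.append h.right
  have hcompl : (A ++ C).toFinset \ (a ++ c).toFinset = F := by
    refine hmax _ ⟨Finset.sdiff_subset, a, c, h, fun v hv => ?_⟩ fun v hv => ?_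
    · simpa using (Finset.mem_sdiff.1 hv).2
    · exact Finset.mem_sdiff.2 ⟨hsub hv, fun h => hav v hv (List.mem_toFinset.1 h)⟩
  have hac_sub : (a ++ c).toFinset ⊆ (A ++ C).toFinset := fun v hv =>
    List.mem_toFinset.2 (hac.subset (List.mem_toFinset.1 hv))
  rw [← hcompl, Finset.card_sdiff_of_subset hac_sub, List.toFinset_card_of_nodup hnd,
    List.toFinset_card_of_nodup (hnd.sublist hac), List.length_append (as := a), ← h.length_eq]
  omega

lemma isPure_factorizationComplex (hnd : (A ++ C).Nodup) :
    IsPure (factorizationComplex cs Q A m C w) := fun F G hF hG => by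
  rw [card_of_isFacet_factorizationComplex hnd hF, card_of_isFacet_factorizationComplex hnd hG]

lemma link_factorizationComplex (hnd : (A ++ v :: C).Nodup) :
    link (factorizationComplex cs Q A m (v :: C) w) {v} = factorizationComplex cs Q A m C w := by
  have hv : v ∉ A ++ C := (List.nodup_middle.1 hnd).notMem
  ext J
  constructor
  · rintro ⟨⟨hJ, -⟩, ⟨-, a, c, h, hav⟩, hdisj⟩
    refine ⟨fun u hu => ?_, a, c, ⟨h.left, ?_, h.prod_eq, h.length_eq⟩,
      fun u hu => hav u (by simp [hu])⟩
    · have hne : u ≠ v := fun h => Finset.disjoint_singleton_left.1 hdisj (h ▸ hu)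
      simpa [hne] using hJ hu
    · rcases List.sublist_cons_iff.1 h.right with hc | ⟨c', rfl, -⟩
      · exact hc
      · exact absurd (by simp) (hav v (by simp))
  · rintro ⟨hJ, a, c, h, hav⟩
    have hJ' : J ⊆ (A ++ v :: C).toFinset := hJ.trans fun u hu => by simp_all
    refine ⟨⟨hJ', a, c, h.cons, hav⟩, ⟨?_, a, c, h.cons, fun u hu => ?_⟩, ?_⟩
    · exact Finset.union_subset (by simp) hJ'
    · rcases Finset.mem_union.1 hu with hu | hu
      · rw [Finset.mem_singleton.1 hu]
        exact fun hmem => hv ((h.left.append h.right).subset hmem)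
      · exact hav u hu
    · exact Finset.disjoint_singleton_left.2 fun hvJ => hv (List.mem_toFinset.1 (hJ hvJ))

lemma mem_deletion_factorizationComplex (hnd : (A ++ v :: C).Nodup) :
    J ∈ deletion (factorizationComplex cs Q A m (v :: C) w) {v} ↔ J ⊆ (A ++ C).toFinset ∧
      ∃ a c, IsFactorization cs Q A m (v :: C) w a c ∧ ∀ v ∈ J, v ∉ a ++ c := by
  have hv : v ∉ A ++ C := (List.nodup_middle.1 hnd).notMem
  have hinsert : (A ++ v :: C).toFinset = insert v (A ++ C).toFinset := by ext; simp
  rw [mem_deletion_singleton, mem_factorizationComplex, hinsert, and_right_comm]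
  refine and_congr_left fun _ => ⟨fun h => (Finset.subset_insert_iff_of_notMem h.2).1 h.1,
    fun h => ⟨h.trans (Finset.subset_insert _ _), fun hvJ => hv (List.mem_toFinset.1 (h hvJ))⟩⟩

lemma deletion_factorizationComplex_of_descent (hnd : (A ++ v :: C).Nodup)
    (hm : cs.length (m * cs.simple (Q v)) < cs.length m) :
    deletion (factorizationComplex cs Q A m (v :: C) w) {v} =
      factorizationComplex cs Q A m C w := by
  ext J
  rw [SetLike.mem_coe, SetLike.mem_coe, mem_deletion_factorizationComplex hnd,
    mem_factorizationComplex]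
  refine and_congr_right fun _ => exists₂_congr fun a c => and_congr_left fun _ =>
    ⟨fun h => ⟨h.left, ?_, h.prod_eq, h.length_eq⟩, .cons⟩
  rcases List.sublist_cons_iff.1 h.right with hc | ⟨c', rfl, hc⟩
  · exact hc
  · exact absurd (h.of_cons_cons hc).1 hm.not_gt

lemma deletion_factorizationComplex_of_ascent (hnd : (A ++ v :: C).Nodup)
    (hw : IsLongestProduct cs Q A m (v :: C) w)
    (hm : cs.length m < cs.length (m * cs.simple (Q v))) :
    deletion (factorizationComplex cs Q A m (v :: C) w) {v} =
      factorizationComplex cs Q A (m * cs.simple (Q v)) C w := by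
  have hv : v ∉ A ++ C := (List.nodup_middle.1 hnd).notMem
  ext J
  rw [SetLike.mem_coe, SetLike.mem_coe, mem_deletion_factorizationComplex hnd,
    mem_factorizationComplex]
  refine and_congr_right fun hJ => ⟨?_, ?_⟩
  · rintro ⟨a, c, h, hav⟩
    rcases List.sublist_cons_iff.1 h.right with hc | ⟨c', rfl, hc⟩
    · obtain ⟨a', c', ha, hc, h'⟩ := hw.exists_isFactorization_of_ascent hm
        ⟨h.left, hc, h.prod_eq, h.length_eq⟩
      exact ⟨a', c', h', fun u hu hmem => hav u hu ((ha.append hc).subset hmem)⟩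
    · exact ⟨a, c', (h.of_cons_cons hc).2, fun u hu hmem =>
        hav u hu (((List.sublist_cons_self v c').append_left a).subset hmem)⟩
  · rintro ⟨a, c, h, hav⟩
    refine ⟨a, v :: c, h.cons_cons hm, fun u hu hmem => ?_⟩
    rcases List.mem_cons.1 (List.perm_middle.mem_iff.1 hmem) with rfl | hmem
    · exact hv (List.mem_toFinset.1 (hJ hu))
    · exact hav u hu hmem

lemma factorizationComplex_nil_nil (h : ∃ a c, IsFactorization cs Q [] m [] w a c) :
    factorizationComplex cs Q [] m [] w = simplex ∅ := by
  refine le_antisymm (fun J hJ => hJ.1) fun J hJ => ?_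
  rw [Finset.subset_empty.1 hJ]
  exact empty_mem_factorizationComplex.2 h

lemma vertexDecomposable_factorizationComplex_of_nil
    (hnil : ∀ m, IsLongestProduct cs Q A m [] w →
      VertexDecomposable (factorizationComplex cs Q A m [] w))
    (hnd : (A ++ C).Nodup) (hw : IsLongestProduct cs Q A m C w) :
    VertexDecomposable (factorizationComplex cs Q A m C w) := by
  induction C generalizing m with
  | nil => exact hnil m hw
  | cons v C ih =>
    have hnd' : (A ++ C).Nodup := (List.nodup_cons.1 (List.nodup_middle.1 hnd)).2
    have hempty := empty_mem_factorizationComplex.2 hw.exists_isFactorization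
    have hdel : VertexDecomposable (deletion (factorizationComplex cs Q A m (v :: C) w) {v}) := by
      have hmem : ∅ ∈ deletion (factorizationComplex cs Q A m (v :: C) w) {v} := ⟨hempty, by simp⟩
      rcases lt_or_gt_of_ne (cs.length_mul_simple_ne m (Q v)) with hm | hm
      · rw [deletion_factorizationComplex_of_descent hnd hm] at hmem ⊢
        exact ih hnd' (hw.of_cons (empty_mem_factorizationComplex.1 hmem))
      · rw [deletion_factorizationComplex_of_ascent hnd hw hm] at hmem ⊢
        exact ih hnd' (hw.of_cons_of_ascent hm (empty_mem_factorizationComplex.1 hmem))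
    by_cases hv : {v} ∈ factorizationComplex cs Q A m (v :: C) w
    · refine .of_vertex _ v (isPure_factorizationComplex hnd) hv hdel ?_
      have hmem : ∅ ∈ link (factorizationComplex cs Q A m (v :: C) w) {v} :=
        ⟨hempty, by simpa using hv, by simp⟩
      rw [link_factorizationComplex hnd] at hmem ⊢
      exact ih hnd' (hw.of_cons (empty_mem_factorizationComplex.1 hmem))
    · rwa [deletion_singleton_eq_self hv] at hdel

theorem vertexDecomposable_factorizationComplex (hnd : (A ++ C).Nodup)
    (hw : IsLongestProduct cs Q A m C w) :
    VertexDecomposable (factorizationComplex cs Q A m C w) := by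
  refine vertexDecomposable_factorizationComplex_of_nil (fun m hw => ?_) hnd hw
  rw [← factorizationComplex_reverse]
  refine vertexDecomposable_factorizationComplex_of_nil (fun m hw => ?_) ?_ hw.reverse
  · rw [List.reverse_nil] at hw ⊢
    rw [factorizationComplex_nil_nil hw.exists_isFactorization]
    exact .of_simplex ∅
  · simpa using hnd.sublist (List.sublist_append_left A C)

variable (cs Q) in
/-- The subword complex of a list of positions: the sets of positions avoided by some subword that
is a reduced expression of `w`. -/
def reducedSubwordComplex (L : List V) (w : W) : LowerSet (Finset V) where
  carrier := {J | J ⊆ L.toFinset ∧ ∃ c, IsReducedSubword cs Q L w c ∧ ∀ v ∈ J, v ∉ c}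
  lower' := fun _ _ hba ⟨hJ, c, h, hav⟩ => ⟨hba.trans hJ, c, h, fun v hv => hav v (hba hv)⟩

variable {L : List V}

lemma mem_reducedSubwordComplex :
    J ∈ reducedSubwordComplex cs Q L w ↔
      J ⊆ L.toFinset ∧ ∃ c, IsReducedSubword cs Q L w c ∧ ∀ v ∈ J, v ∉ c := Iff.rfl

lemma empty_mem_reducedSubwordComplex :
    ∅ ∈ reducedSubwordComplex cs Q L w ↔ ∃ c, IsReducedSubword cs Q L w c := by
  simp [mem_reducedSubwordComplex]

lemma factorizationComplex_one :
    factorizationComplex cs Q A 1 C w = reducedSubwordComplex cs Q (A ++ C) w := by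
  ext J
  refine and_congr_right fun _ => ⟨?_, ?_⟩
  · rintro ⟨a, c, h, hav⟩
    exact ⟨a ++ c, (isFactorization_one_iff.1 h).2.2, hav⟩
  · rintro ⟨d, h, hav⟩
    obtain ⟨a, c, rfl, ha, hc⟩ := List.sublist_append_iff.1 h.sublist
    exact ⟨a, c, isFactorization_one_iff.2 ⟨ha, hc, h⟩, hav⟩

lemma subwordComplex_eq_reducedSubwordComplex {r : ℕ} (Q : Fin r → B) :
    subwordComplex cs Q w = reducedSubwordComplex cs Q (List.finRange r) w := by
  ext J
  constructor
  · rintro ⟨I, hJI, hprod, hred⟩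
    refine ⟨by simp, (List.finRange r).filter (· ∈ Iᶜ), ⟨List.filter_sublist, hprod, ?_⟩,
      fun v hv => by simp [hJI hv]⟩
    rw [← hprod, hred, subwordAt, List.length_map]
  · rintro ⟨-, c, h, hav⟩
    have hnd := List.nodup_finRange r
    have hc : (List.finRange r).filter (· ∈ c) = c :=
      (hnd.perm_iff_eq_of_sublist List.filter_sublist h.sublist).1
        ((List.perm_ext_iff_of_nodup (hnd.filter _) (hnd.sublist h.sublist)).2 (by simp))
    refine ⟨c.toFinsetᶜ, fun v hv => by simpa using hav v hv, ?_⟩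
    have hsub : subwordAt Q c.toFinsetᶜᶜ = c.map Q := by simp [subwordAt, hc]
    rw [hsub]
    refine ⟨h.prod_eq, ?_⟩
    rw [CoxeterSystem.IsReduced, h.prod_eq, ← h.length_eq, List.length_map]

end Complexes

section TietzeExtension

open SimpComplex

universe u v

variable {B W : Type*} {V : Type v} [Group W] {M : CoxeterMatrix B} {cs : CoxeterSystem M W}
  {Q : V → B} [DecidableEq V] {L : List V} {v : V} {w : W} {J : Finset V}

lemma mem_cone_reducedSubwordComplex (hv : v ∉ L) :
    J ∈ cone v (reducedSubwordComplex cs Q L w) ↔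
      J ⊆ (v :: L).toFinset ∧ ∃ c, IsReducedSubword cs Q L w c ∧ ∀ u ∈ J, u ∉ c := by
  rw [mem_cone, mem_reducedSubwordComplex, List.toFinset_cons, Finset.subset_insert_iff]
  refine and_congr_right fun _ => exists_congr fun c => and_congr_right fun hc =>
    ⟨fun h u hu => ?_, fun h u hu => h u (Finset.mem_of_mem_erase hu)⟩
  rcases eq_or_ne u v with rfl | huv
  · exact fun huc => hv (hc.sublist.subset huc)
  · exact h u (Finset.mem_erase.2 ⟨huv, hu⟩)

lemma cone_reducedSubwordComplex_le_cons (hv : v ∉ L) :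
    cone v (reducedSubwordComplex cs Q L w) ≤ reducedSubwordComplex cs Q (v :: L) w := by
  intro J hJ
  obtain ⟨hJ, c, hc, hav⟩ := (mem_cone_reducedSubwordComplex hv).1 hJ
  exact ⟨hJ, c, hc.cons, hav⟩

lemma reducedSubwordComplex_cons_of_ascent (hv : v ∉ L)
    (hw : cs.length w < cs.length (cs.simple (Q v) * w)) :
    reducedSubwordComplex cs Q (v :: L) w = cone v (reducedSubwordComplex cs Q L w) := by
  refine le_antisymm (fun J ⟨hJ, c, hc, hav⟩ => ?_) (cone_reducedSubwordComplex_le_cons hv)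
  exact (mem_cone_reducedSubwordComplex hv).2
    ⟨hJ, c, hc.of_cons.resolve_right fun h => hw.not_gt h.1, hav⟩

lemma reducedSubwordComplex_le_of_descent (hw : cs.length (cs.simple (Q v) * w) < cs.length w) :
    reducedSubwordComplex cs Q L w ≤ reducedSubwordComplex cs Q L (cs.simple (Q v) * w) := by
  rintro J ⟨hJ, c, hc, hav⟩
  obtain ⟨c', hcc', hc'⟩ := hc.exists_of_descent hw
  exact ⟨hJ, c', hc', fun u hu huc => hav u hu (hcc'.subset huc)⟩

lemma reducedSubwordComplex_le_cons_of_descent (hv : v ∉ L)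
    (hw : cs.length (cs.simple (Q v) * w) < cs.length w) :
    reducedSubwordComplex cs Q L (cs.simple (Q v) * w) ≤ reducedSubwordComplex cs Q (v :: L) w := by
  rintro J ⟨hJ, c, hc, hav⟩
  have hvJ : v ∉ J := fun h => hv (List.mem_toFinset.1 (hJ h))
  refine ⟨fun u hu => ?_, v :: c, hc.cons_cons hw, fun u hu => ?_⟩
  · exact List.mem_toFinset.2 (.tail v (List.mem_toFinset.1 (hJ hu)))
  · exact List.not_mem_cons_of_ne_of_not_mem (ne_of_mem_of_not_mem hu hvJ) (hav u hu)

lemma reducedSubwordComplex_cons_of_descent (hv : v ∉ L)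
    (hw : cs.length (cs.simple (Q v) * w) < cs.length w) :
    reducedSubwordComplex cs Q (v :: L) w =
      reducedSubwordComplex cs Q L (cs.simple (Q v) * w) ⊔
        cone v (reducedSubwordComplex cs Q L w) := by
  refine le_antisymm (fun J ⟨hJ, c, hc, hav⟩ => ?_) (sup_le
    (reducedSubwordComplex_le_cons_of_descent hv hw) (cone_reducedSubwordComplex_le_cons hv))
  rcases hc.of_cons with hc | ⟨-, c', rfl, hc'⟩
  · exact .inr ((mem_cone_reducedSubwordComplex hv).2 ⟨hJ, c, hc, hav⟩)
  · have hvJ : v ∉ J := fun h => hav v h List.mem_cons_self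
    rw [List.toFinset_cons, Finset.subset_insert_iff_of_notMem hvJ] at hJ
    exact .inl ⟨hJ, c', hc', fun u hu huc => hav u hu (List.mem_cons_of_mem v huc)⟩

lemma reducedSubwordComplex_inf_cone (hv : v ∉ L)
    (hw : cs.length (cs.simple (Q v) * w) < cs.length w) :
    reducedSubwordComplex cs Q L (cs.simple (Q v) * w) ⊓ cone v (reducedSubwordComplex cs Q L w) =
      reducedSubwordComplex cs Q L w := by
  refine le_antisymm (fun J ⟨hJ, hcone⟩ => ?_) (le_inf (reducedSubwordComplex_le_of_descent hw)
    fun J hJ => (reducedSubwordComplex cs Q L w).lower (Finset.erase_subset v J) hJ)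
  have hvJ : v ∉ J := fun h => hv (List.mem_toFinset.1 (hJ.1 h))
  rwa [SetLike.mem_coe, mem_cone, Finset.erase_eq_of_notMem hvJ] at hcone

theorem tietzeExtension_barycentric_reducedSubwordComplex [Fintype V] (hnd : L.Nodup)
    (hw : ∃ c, IsReducedSubword cs Q L w c) (hne : w ≠ demazureProduct cs (L.map Q)) :
    TietzeExtension.{u, v} (barycentric (reducedSubwordComplex cs Q L w)) := by
  induction L generalizing w with
  | nil =>
    obtain ⟨c, hc⟩ := hw
    exact absurd (isReducedSubword_nil_iff.1 hc).1 hne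
  | cons v L ih =>
    obtain ⟨hv, hnd⟩ := List.nodup_cons.1 hnd
    obtain ⟨c, hc⟩ := hw
    have hcone (hL : ∃ c, IsReducedSubword cs Q L w c) :=
      tietzeExtension_barycentric_cone.{u} (v := v) (empty_mem_reducedSubwordComplex.2 hL)
    rcases lt_or_gt_of_ne (cs.length_simple_mul_ne w (Q v)) with hdesc | hasc
    · obtain ⟨hne_mul, hne⟩ := ne_demazureProduct_of_ne_demazureProduct_cons hdesc hne
      have hL_mul : ∃ c, IsReducedSubword cs Q L (cs.simple (Q v) * w) c := by
        rcases hc.of_cons with h | ⟨-, c, -, h⟩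
        exacts [(h.exists_of_descent hdesc).imp fun _ => And.right, ⟨c, h⟩]
      by_cases hL : ∃ c, IsReducedSubword cs Q L w c
      · rw [reducedSubwordComplex_cons_of_descent hv hdesc]
        refine tietzeExtension_barycentric_sup (ih hnd hL_mul hne_mul) (hcone hL) ?_
        rw [reducedSubwordComplex_inf_cone hv hdesc]
        exact ih hnd hL hne
      · have hbot : cone v (reducedSubwordComplex cs Q L w) ≤
            reducedSubwordComplex cs Q L (cs.simple (Q v) * w) := fun J hJ =>
          absurd (hJ.2.imp fun _ => And.left) hL
        rw [reducedSubwordComplex_cons_of_descent hv hdesc, sup_of_le_left hbot]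
        exact ih hnd hL_mul hne_mul
    · rw [reducedSubwordComplex_cons_of_ascent hv hasc]
      exact hcone ⟨c, hc.of_cons.resolve_right fun h => hasc.not_gt h.1⟩

end TietzeExtension

section Deletion

open SimpComplex

variable {B W V : Type*} [Group W] {M : CoxeterMatrix B} {cs : CoxeterSystem M W} {Q : V → B}
  {A C L : List V} {w : W} {v : V}

lemma IsReducedSubword.isLongestProduct_one {c : List V} (h : IsReducedSubword cs Q (A ++ C) w c)
    (hw : w = demazureProduct cs ((A ++ C).map Q)) : IsLongestProduct cs Q A 1 C w where
  exists_isFactorization := by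
    obtain ⟨a, c, rfl, ha, hc⟩ := List.sublist_append_iff.1 h.sublist
    exact ⟨a, c, isFactorization_one_iff.2 ⟨ha, hc, h⟩⟩
  length_le _ _ _ hac := hw ▸ (isFactorization_one_iff.1 hac).2.2.length_le_demazureProduct

theorem vertexDecomposable_deletion_reducedSubwordComplex [DecidableEq V] (hnd : L.Nodup)
    (hv : v ∈ L) (hL : ∃ c, IsReducedSubword cs Q L w c)
    (hw : w = demazureProduct cs (L.map Q)) :
    VertexDecomposable (deletion (reducedSubwordComplex cs Q L w) {v}) := by
  have hempty : ∅ ∈ deletion (reducedSubwordComplex cs Q L w) {v} :=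
    ⟨empty_mem_reducedSubwordComplex.2 hL, by simp⟩
  obtain ⟨A, C, rfl⟩ := List.append_of_mem hv
  obtain ⟨c, hc⟩ := hL
  have hlongest := hc.isLongestProduct_one hw
  have hascent : cs.length 1 < cs.length (1 * cs.simple (Q v)) := by simp
  rw [← factorizationComplex_one, deletion_factorizationComplex_of_ascent hnd hlongest hascent]
    at hempty ⊢
  exact vertexDecomposable_factorizationComplex (List.nodup_middle.1 hnd).of_cons
    (hlongest.of_cons_of_ascent hascent (empty_mem_factorizationComplex.1 hempty))

theorem eq_demazureProduct_of_isSpherical [Fintype V] [DecidableEq V] (hnd : L.Nodup)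
    (hL : ∃ c, IsReducedSubword cs Q L w c) (hsph : IsSpherical (reducedSubwordComplex cs Q L w)) :
    w = demazureProduct cs (L.map Q) := by
  by_contra hne
  refine not_isSpherical_of_tietzeExtension ?_ hsph
  rw [realization_eq_barycentric]
  exact tietzeExtension_barycentric_reducedSubwordComplex hnd hL hne

end Deletion

end SubwordComplex

open SubwordComplex in
theorem mainTheorem6_general {B W : Type*} [Group W] {M : CoxeterMatrix B} {cs : CoxeterSystem M W}
    {r : ℕ} {Q : Fin r → B} {w : W} (hsph : SimpComplex.IsSpherical (subwordComplex cs Q w))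
    (hne : ∅ ∈ subwordComplex cs Q w) (i : Fin r) :
    SimpComplex.VertexDecomposable (SimpComplex.deletion (subwordComplex cs Q w) {i}) := by
  rw [subwordComplex_eq_reducedSubwordComplex] at hsph hne ⊢
  have hred := empty_mem_reducedSubwordComplex.1 hne
  have hnd := List.nodup_finRange r
  exact vertexDecomposable_deletion_reducedSubwordComplex hnd (List.mem_finRange i) hred
    (eq_demazureProduct_of_isSpherical hnd hred hsph)

theorem mainTheorem6 {B W : Type*} [Group W] [Finite W] {M : CoxeterMatrix B}
    (cs : CoxeterSystem M W) {r : ℕ} (Q : Fin r → B) (w : W)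
    (hsph : SimpComplex.IsSpherical (subwordComplex cs Q w))
    (i : Fin r) (hi : {i} ∈ subwordComplex cs Q w) :
    SimpComplex.VertexDecomposable (SimpComplex.deletion (subwordComplex cs Q w) {i}) :=
  mainTheorem6_general hsph (LowerSet.lower _ (Finset.empty_subset {i}) hi) i
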